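/- Write $(a;q)_n=\prod_{j=0}^{n-1}(1-aq^j)$ for $n\in\mathbb{N}_0\cup\{\infty\}$, and define integers $c(n)$ and formal power series $A(q),B(q)\in\mathbb{Z}[[q]]$ by \[ \sum_{n\ge 0}c(n)q^n:=\sum_{n\ge 0}\frac{(-q^{2n+2};q^2)_\infty\, q^{2n+1}}{(q^{2n+1};q^2)_\infty^2},\qquad A(q):=\frac{(-q^2;q^2)_\infty}{(q;q^2)_\infty^2},\qquad B(q):=\sum_{n\ge 0}\frac{(-q^2;q^2)_n\, q^{n(n+1)}}{(q;q^2)_{n+1}^2}. \] Then for all integers $n\ge 0$ we have \[ c(8n+6)\equiv 0\pmod 8, \] and moreover, for all integers $n\ge 0$, the coefficient of $q^{4n+1}$ in $A(q)B(-q)$ is divisible by $4$. -/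

import Mathlib

namespace TwoColor

open PowerSeries Filter
open scoped PowerSeries.WithPiTopology Topology

/-- The finite `q`-Pochhammer symbol `(a;q)_n = ∏_{j=0}^{n-1} (1 - a q^j)`,
for formal power series `a`, `q` with integer coefficients. -/
noncomputable def qPoch (a q : ℤ⟦X⟧) (n : ℕ) : ℤ⟦X⟧ :=
  ∏ j ∈ Finset.range n, (1 - a * q ^ j)

/-- The infinite `q`-Pochhammer symbol `(a;q)_∞ = ∏_{j≥0} (1 - a q^j)`; the product converges
coefficientwise as soon as `q` has zero constant term, see `multipliable_qPoch`. -/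
noncomputable def qPochInf (a q : ℤ⟦X⟧) : ℤ⟦X⟧ :=
  ∏' j : ℕ, (1 - a * q ^ j)

/-- The reciprocal `1 / f` of a formal power series `f` with constant term `1`
(the only case in which it is used), see `mul_recip`. -/
noncomputable def recip (f : ℤ⟦X⟧) : ℤ⟦X⟧ :=
  PowerSeries.invOfUnit f 1

/-- The `n`-th summand `(-q^{2n+2};q^2)_∞ q^{2n+1} / (q^{2n+1};q^2)_∞^2` of `C(q)`. -/
noncomputable def CTerm (n : ℕ) : ℤ⟦X⟧ :=
  qPochInf (-X ^ (2 * n + 2)) (X ^ 2) * X ^ (2 * n + 1)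
    * recip (qPochInf (X ^ (2 * n + 1)) (X ^ 2) ^ 2)

/-- `C(q) = ∑_{n≥0} (-q^{2n+2};q^2)_∞ q^{2n+1} / (q^{2n+1};q^2)_∞^2`. -/
noncomputable def CSeries : ℤ⟦X⟧ := ∑' n : ℕ, CTerm n

/-- `c(n)`, the coefficient of `q^n` in `C(q)`. -/
noncomputable def c (n : ℕ) : ℤ := coeff n CSeries

/-- `A(q) = (-q^2;q^2)_∞ / (q;q^2)_∞^2`. -/
noncomputable def ASeries : ℤ⟦X⟧ :=
  qPochInf (-X ^ 2) (X ^ 2) * recip (qPochInf X (X ^ 2) ^ 2)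

/-- The `n`-th summand `(-q^2;q^2)_n q^{n(n+1)} / (q;q^2)_{n+1}^2` of `B(q)`. -/
noncomputable def BTerm (n : ℕ) : ℤ⟦X⟧ :=
  qPoch (-X ^ 2) (X ^ 2) n * X ^ (n * (n + 1)) * recip (qPoch X (X ^ 2) (n + 1) ^ 2)

/-- McIntosh's second order mock theta function
`B(q) = ∑_{n≥0} (-q^2;q^2)_n q^{n(n+1)} / (q;q^2)_{n+1}^2`, as a formal power series. -/
noncomputable def BSeries : ℤ⟦X⟧ := ∑' n : ℕ, BTerm n

/-! The infinite products, reciprocals and infinite sums above are genuine. -/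

theorem mul_recip {f : ℤ⟦X⟧} (h : constantCoeff f = 1) : f * recip f = 1 :=
  PowerSeries.mul_invOfUnit f 1 (by simpa using h)

theorem multipliable_qPoch (a : ℤ⟦X⟧) {q : ℤ⟦X⟧} (hq : constantCoeff q = 0) :
    Multipliable fun j : ℕ => 1 - a * q ^ j := by
  simp_rw [sub_eq_add_neg]
  apply WithPiTopology.multipliable_one_add_of_tendsto_order_atTop_nhds_top
  refine ENat.tendsto_nhds_top_iff_natCast_lt.mpr fun n => eventually_atTop.mpr ⟨n + 1, ?_⟩
  intro m hm
  rw [order_neg]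
  refine lt_of_lt_of_le (b := (m : ℕ∞)) (by exact_mod_cast hm) ?_
  refine PowerSeries.le_order _ _ fun i hi => ?_
  have hi' : i < m := by exact_mod_cast hi
  have hd : (X : ℤ⟦X⟧) ^ m ∣ a * q ^ m :=
    Dvd.dvd.mul_left (pow_dvd_pow_of_dvd (X_dvd_iff.mpr hq) m) a
  exact X_pow_dvd_iff.mp hd i hi'

theorem constantCoeff_qPochInf {a q : ℤ⟦X⟧} (ha : constantCoeff a = 0)
    (hq : constantCoeff q = 0) : constantCoeff (qPochInf a q) = 1 := by
  rw [qPochInf, (multipliable_qPoch a hq).map_tprod _ (WithPiTopology.continuous_constantCoeff ℤ)]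
  simp [ha]

theorem constantCoeff_qPoch {a : ℤ⟦X⟧} (q : ℤ⟦X⟧) (ha : constantCoeff a = 0) (n : ℕ) :
    constantCoeff (qPoch a q n) = 1 := by
  simp [qPoch, map_prod, ha]

theorem summable_of_X_pow_dvd {f : ℕ → ℤ⟦X⟧} (h : ∀ n, X ^ n ∣ f n) : Summable f := by
  apply WithPiTopology.summable_of_tendsto_order_atTop_nhds_top
  refine ENat.tendsto_nhds_top_iff_natCast_lt.mpr fun n => eventually_atTop.mpr ⟨n + 1, ?_⟩
  intro m hm
  refine lt_of_lt_of_le (b := (m : ℕ∞)) (by exact_mod_cast hm) ?_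
  refine PowerSeries.le_order _ _ fun i hi => ?_
  exact X_pow_dvd_iff.mp (h m) i (by exact_mod_cast hi)

theorem summable_CTerm : Summable CTerm :=
  summable_of_X_pow_dvd fun n =>
    Dvd.dvd.mul_right (Dvd.dvd.mul_left (pow_dvd_pow X (by omega)) _) _

theorem summable_BTerm : Summable BTerm :=
  summable_of_X_pow_dvd fun n =>
    Dvd.dvd.mul_right (Dvd.dvd.mul_left (pow_dvd_pow X (by nlinarith)) _) _

end TwoColor

namespace TwoColor

open PowerSeries Filter
open scoped PowerSeries.WithPiTopology Topology

/-! Every infinite identity is proved as a congruence modulo `X ^ N` between finite expressions. Put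
θ = ∑_{k≥1} (-1)^k q^{k²}; the triple product gives (q;q²)_∞² (q²;q²)_∞ = 1 + 2θ.

For c: clearing denominators gives C(q)(1 + 2θ) = qV, where V = (q⁴;q⁴)_∞ ∑ (q;q²)_n²
q^{2n}/(-q²;q²)_n. Expanding (q;q²)_n² by the finite triple product and summing over n by a
telescoping recurrence (`gammaTerm_telescope`) turns V into a Hecke-type double sum (`hecke_XCong`).
Its exponents are never 1, 4 or 5 mod 8, and its coefficients of odd index are even. Since (1 +
2θ)(1 - 2θ + 4θ²) = 1 + 8θ³, modulo 8 the coefficient of q^{8n+6} in C is that of q^{8n+5} in V -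
2Vθ + 4Vθ². The first two terms contribute 0 because squares are 0, 1, 4 mod 8; the third
contributes a multiple of 8 by parity.

For AB(-q): partial fractions of 1/(q;q²)_{n+1}² and a second telescoping sum express (q²;q²)_∞ B as
an Appell-Lerch type sum (`BSeries_XCong`). Hence A(q)B(-q)(1 + 2θ) = (-q²;q²)_∞² (T + 2F), with T a
theta series in q⁴ and F a sum over factorisations. Multiplying by 1 - 2θ and using (-q²;q²)_∞² ≡
(q⁴;q⁴)_∞ mod 2 reduces the claim to F ≡ θT mod 2 at indices m ≡ 1 mod 4. This compares 2m + 1 = x²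
+ 2y² with 2m + 1 = x(x + 2z); both count, mod 2, the solutions of x² + 2yz = 2m + 1, as fixed
points of two involutions (`card_sq_rep_eq_card_factor`). -/

/-! ### Truncation modulo powers of X -/

/-- Congruence of power series modulo `X ^ N`. -/
def XCong (N : ℕ) (f g : ℤ⟦X⟧) : Prop := X ^ N ∣ f - g

namespace XCong

variable {N K : ℕ} {f g h f' g' : ℤ⟦X⟧}

theorem refl (N : ℕ) (f : ℤ⟦X⟧) : XCong N f f := by simp [XCong]

theorem of_eq (h : f = g) : XCong N f g := h ▸ refl N f

theorem symm (h : XCong N f g) : XCong N g f := by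
  unfold XCong at *; rw [← neg_sub]; exact (dvd_neg).mpr h

theorem trans (h₁ : XCong N f g) (h₂ : XCong N g h) : XCong N f h := by
  unfold XCong at *; rw [← sub_add_sub_cancel f g h]; exact dvd_add h₁ h₂

theorem add (h₁ : XCong N f g) (h₂ : XCong N f' g') : XCong N (f + f') (g + g') := by
  unfold XCong at *; rw [add_sub_add_comm]; exact dvd_add h₁ h₂

theorem neg (h₁ : XCong N f g) : XCong N (-f) (-g) := by
  unfold XCong at *; rw [← neg_sub', dvd_neg]; exact h₁

theorem sub (h₁ : XCong N f g) (h₂ : XCong N f' g') : XCong N (f - f') (g - g') := by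
  rw [sub_eq_add_neg, sub_eq_add_neg]; exact h₁.add h₂.neg

theorem mul (h₁ : XCong N f g) (h₂ : XCong N f' g') : XCong N (f * f') (g * g') := by
  unfold XCong at *
  have : f * f' - g * g' = (f - g) * f' + g * (f' - g') := by ring
  rw [this]; exact dvd_add (h₁.mul_right _) (h₂.mul_left _)

theorem mul_left (h : ℤ⟦X⟧) (h₁ : XCong N f g) : XCong N (h * f) (h * g) := (refl N h).mul h₁

theorem mul_right (h : ℤ⟦X⟧) (h₁ : XCong N f g) : XCong N (f * h) (g * h) := h₁.mul (refl N h)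

theorem pow (h₁ : XCong N f g) (k : ℕ) : XCong N (f ^ k) (g ^ k) := by
  induction k with
  | zero => simpa using refl N 1
  | succ k ih => rw [pow_succ, pow_succ]; exact ih.mul h₁

theorem mono (hK : K ≤ N) (h : XCong N f g) : XCong K f g := (pow_dvd_pow X hK).trans h

theorem sum {ι : Type*} {s : Finset ι} {F G : ι → ℤ⟦X⟧} (h : ∀ i ∈ s, XCong N (F i) (G i)) :
    XCong N (∑ i ∈ s, F i) (∑ i ∈ s, G i) := by
  unfold XCong at *; rw [← Finset.sum_sub_distrib]; exact Finset.dvd_sum h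

theorem coeff_eq (h : XCong N f g) {n : ℕ} (hn : n < N) : coeff n f = coeff n g := by
  have := X_pow_dvd_iff.mp h n hn
  rwa [map_sub, sub_eq_zero] at this

theorem of_coeff (h : ∀ n < N, coeff n f = coeff n g) : XCong N f g :=
  X_pow_dvd_iff.mpr fun n hn => by rw [map_sub, h n hn, sub_self]

theorem zero_of_dvd (h : X ^ N ∣ f) : XCong N f 0 := by simpa [XCong] using h

theorem X_pow_mul (hf : XCong N f g) (k : ℕ) : XCong (N + k) (X ^ k * f) (X ^ k * g) := by
  unfold XCong at *; rw [← mul_sub, add_comm, pow_add]; exact mul_dvd_mul_left _ hf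

theorem of_X_pow_mul {k : ℕ} (hf : XCong (N + k) (X ^ k * f) (X ^ k * g)) : XCong N f g := by
  unfold XCong at *; rw [← mul_sub, add_comm, pow_add] at hf
  exact (mul_dvd_mul_iff_left (pow_ne_zero _ X_ne_zero)).mp hf

/-- Series with constant term `1` can be cancelled. -/
theorem cancel_left {u : ℤ⟦X⟧} (hu : constantCoeff u = 1) (h : XCong N (u * f) (u * g)) :
    XCong N f g := by
  have := h.mul_left (recip u)
  rwa [← mul_assoc, ← mul_assoc, mul_comm (recip u), mul_recip hu, one_mul, one_mul] at this

theorem map_evalNeg (h : XCong N f g) : XCong N (evalNegHom f) (evalNegHom g) := by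
  unfold XCong at *
  obtain ⟨k, hk⟩ := h
  rw [← map_sub, hk, map_mul, map_pow, evalNegHom_X, neg_pow]
  exact Dvd.intro ((-1) ^ N * evalNegHom k) (by ring)

end XCong

theorem eq_of_forall_XCong {f g : ℤ⟦X⟧} (h : ∀ N, XCong N f g) : f = g :=
  PowerSeries.ext fun n => (h (n + 1)).coeff_eq n.lt_succ_self

theorem coeff_eventually_eq {F : ℕ → ℤ⟦X⟧} {f : ℤ⟦X⟧} (h : Tendsto F atTop (𝓝 f)) (n : ℕ) :
    ∀ᶠ k in atTop, coeff n (F k) = coeff n f := by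
  have h' := (WithPiTopology.continuous_coeff ℤ n).tendsto f |>.comp h
  rw [nhds_discrete] at h'
  exact tendsto_pure.mp h'

theorem XCong_of_tendsto {F : ℕ → ℤ⟦X⟧} {f g : ℤ⟦X⟧} (h : Tendsto F atTop (𝓝 f)) {N : ℕ}
    (hF : ∀ᶠ k in atTop, XCong N (F k) g) : XCong N f g :=
  XCong.of_coeff fun n hn => by
    obtain ⟨k, h₁, h₂⟩ := ((coeff_eventually_eq h n).and hF).exists
    rw [← h₁, h₂.coeff_eq hn]

/-! ### Finite approximation of infinite products and sums -/

theorem qPoch_succ (a q : ℤ⟦X⟧) (n : ℕ) : qPoch a q (n + 1) = qPoch a q n * (1 - a * q ^ n) :=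
  Finset.prod_range_succ _ _

theorem qPoch_zero (a q : ℤ⟦X⟧) : qPoch a q 0 = 1 := Finset.prod_range_zero _

theorem qPoch_XCong {a q : ℤ⟦X⟧} {N n m : ℕ} (h : X ^ N ∣ a * q ^ n) (hm : n ≤ m) :
    XCong N (qPoch a q m) (qPoch a q n) := by
  induction m, hm using Nat.le_induction with
  | base => exact XCong.refl _ _
  | succ m hm ih =>
    refine XCong.trans ?_ ih
    rw [qPoch_succ, XCong]
    obtain ⟨k, rfl⟩ := Nat.exists_eq_add_of_le hm
    obtain ⟨t, ht⟩ := h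
    rw [pow_add, ← mul_assoc a, ht]
    exact ⟨-(qPoch a q (n + k) * t * q ^ k), by ring⟩

theorem qPochInf_XCong {a q : ℤ⟦X⟧} (hq : constantCoeff q = 0) {N n : ℕ} (h : X ^ N ∣ a * q ^ n) :
    XCong N (qPochInf a q) (qPoch a q n) :=
  XCong_of_tendsto (multipliable_qPoch a hq).hasProd.tendsto_prod_nat
    (eventually_atTop.mpr ⟨n, fun _ hm => qPoch_XCong h hm⟩)

theorem X_pow_dvd_mul_pow (a : ℤ⟦X⟧) {q : ℤ⟦X⟧} (hq : constantCoeff q = 0) (n : ℕ) :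
    X ^ n ∣ a * q ^ n :=
  Dvd.dvd.mul_left (pow_dvd_pow_of_dvd (X_dvd_iff.mpr hq) n) a

theorem qPoch_add (a q : ℤ⟦X⟧) (n m : ℕ) :
    qPoch a q (n + m) = qPoch a q n * qPoch (a * q ^ n) q m := by
  unfold qPoch
  rw [Finset.prod_range_add]
  congr 1
  exact Finset.prod_congr rfl fun j _ => by rw [pow_add]; ring

theorem qPochInf_split {a q : ℤ⟦X⟧} (hq : constantCoeff q = 0) (n : ℕ) :
    qPochInf a q = qPoch a q n * qPochInf (a * q ^ n) q := by
  refine eq_of_forall_XCong fun N => ?_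
  have h₁ : XCong N (qPochInf a q) (qPoch a q (n + N)) :=
    (qPochInf_XCong hq (X_pow_dvd_mul_pow a hq (n + N))).mono (by omega)
  have h₂ := qPochInf_XCong hq (X_pow_dvd_mul_pow (a * q ^ n) hq N)
  rw [qPoch_add] at h₁
  exact h₁.trans (h₂.mul_left _).symm

theorem tsum_XCong {F : ℕ → ℤ⟦X⟧} (h : ∀ n, X ^ n ∣ F n) (N : ℕ) :
    XCong N (∑' n, F n) (∑ n ∈ Finset.range N, F n) := by
  refine XCong_of_tendsto (summable_of_X_pow_dvd h).hasSum.tendsto_sum_nat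
    (eventually_atTop.mpr ⟨N, fun m hm => ?_⟩)
  obtain ⟨k, rfl⟩ := Nat.exists_eq_add_of_le hm
  rw [XCong, Finset.sum_range_add_sub_sum_range]
  exact Finset.dvd_sum fun i _ => (pow_dvd_pow X (by omega)).trans (h _)

/-! ### Factorials in base q², their reciprocals and Bailey kernels -/

/-- The `q`-factorial `(q^2;q^2)_n`. -/
noncomputable def qfac (n : ℕ) : ℤ⟦X⟧ := qPoch (X ^ 2) (X ^ 2) n

/-- The product `(-q^2;q^2)_n`. -/
noncomputable def mfac (n : ℕ) : ℤ⟦X⟧ := qPoch (-X ^ 2) (X ^ 2) n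

/-- The product `(q;q^2)_n`. -/
noncomputable def ofac (n : ℕ) : ℤ⟦X⟧ := qPoch X (X ^ 2) n

theorem qfac_succ (n : ℕ) : qfac (n + 1) = qfac n * (1 - X ^ (2 * (n + 1))) := by
  rw [qfac, qfac, qPoch_succ]; ring

theorem mfac_succ (n : ℕ) : mfac (n + 1) = mfac n * (1 + X ^ (2 * (n + 1))) := by
  rw [mfac, mfac, qPoch_succ]; ring

theorem ofac_succ (n : ℕ) : ofac (n + 1) = ofac n * (1 - X ^ (2 * n + 1)) := by
  rw [ofac, ofac, qPoch_succ]; ring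

theorem qfac_zero : qfac 0 = 1 := qPoch_zero _ _

theorem mfac_zero : mfac 0 = 1 := qPoch_zero _ _

theorem ofac_zero : ofac 0 = 1 := qPoch_zero _ _

theorem constantCoeff_qfac (n : ℕ) : constantCoeff (qfac n) = 1 :=
  constantCoeff_qPoch _ (by simp) n

theorem constantCoeff_mfac (n : ℕ) : constantCoeff (mfac n) = 1 :=
  constantCoeff_qPoch _ (by simp) n

theorem constantCoeff_ofac (n : ℕ) : constantCoeff (ofac n) = 1 :=
  constantCoeff_qPoch _ (by simp) n

theorem eq_of_mul_eq {u f g : ℤ⟦X⟧} (hu : constantCoeff u = 1) (h : u * f = u * g) : f = g := by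
  have h0 : u ≠ 0 := by rintro rfl; simp at hu
  exact mul_left_cancel₀ h0 h

theorem recip_eq_of_mul_eq_one {f g : ℤ⟦X⟧} (hf : constantCoeff f = 1) (h : f * g = 1) :
    recip f = g :=
  eq_of_mul_eq hf (by rw [mul_recip hf, h])

/-- The reciprocal of `(q^2;q^2)_n`. -/
noncomputable def qfacInv (n : ℕ) : ℤ⟦X⟧ := recip (qfac n)

/-- The reciprocal of `(-q^2;q^2)_n`. -/
noncomputable def mfacInv (n : ℕ) : ℤ⟦X⟧ := recip (mfac n)

theorem qfac_mul_inv (n : ℕ) : qfac n * qfacInv n = 1 := mul_recip (constantCoeff_qfac n)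

theorem mfac_mul_inv (n : ℕ) : mfac n * mfacInv n = 1 := mul_recip (constantCoeff_mfac n)

theorem qfacInv_succ (n : ℕ) : qfacInv n = qfacInv (n + 1) * (1 - X ^ (2 * (n + 1))) := by
  refine eq_of_mul_eq (constantCoeff_qfac n) ?_
  have h := qfac_mul_inv (n + 1)
  rw [qfac_succ] at h
  rw [qfac_mul_inv]; linear_combination -h

theorem mfacInv_succ (n : ℕ) : mfacInv n = mfacInv (n + 1) * (1 + X ^ (2 * (n + 1))) := by
  refine eq_of_mul_eq (constantCoeff_mfac n) ?_
  have h := mfac_mul_inv (n + 1)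
  rw [mfac_succ] at h
  rw [mfac_mul_inv]; linear_combination -h

theorem qfacInv_zero : qfacInv 0 = 1 :=
  recip_eq_of_mul_eq_one (constantCoeff_qfac 0) (by rw [qfac_zero, one_mul])

/-- `1 / ((q^2;q^2)_{n-r} (q^2;q^2)_{n+r})`, understood as `0` for `r > n`. -/
noncomputable def evenKernel (n r : ℕ) : ℤ⟦X⟧ :=
  if r ≤ n then qfacInv (n - r) * qfacInv (n + r) else 0

/-- `1 / ((q^2;q^2)_{n-r} (q^2;q^2)_{n+r+1})`, understood as `0` for `r > n`. -/
noncomputable def oddKernel (n r : ℕ) : ℤ⟦X⟧ :=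
  if r ≤ n then qfacInv (n - r) * qfacInv (n + r + 1) else 0

theorem evenKernel_add (r d : ℕ) : evenKernel (r + d) r = qfacInv d * qfacInv (2 * r + d) := by
  rw [evenKernel, if_pos (by omega)]
  congr 2 <;> omega

theorem oddKernel_add (r d : ℕ) : oddKernel (r + d) r = qfacInv d * qfacInv (2 * r + d + 1) := by
  rw [oddKernel, if_pos (by omega)]
  congr 2 <;> omega

theorem evenKernel_of_lt {n r : ℕ} (h : n < r) : evenKernel n r = 0 := if_neg (by omega)

theorem oddKernel_of_lt {n r : ℕ} (h : n < r) : oddKernel n r = 0 := if_neg (by omega)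

theorem evenKernel_add_succ (r d : ℕ) :
    evenKernel (r + d) (r + 1) = qfacInv d * qfacInv (2 * r + d + 1) * (1 - X ^ (2 * d)) := by
  rcases d with _ | d
  · rw [evenKernel_of_lt (by omega)]; simp
  · rw [show r + (d + 1) = (r + 1) + d by ring, evenKernel_add, qfacInv_succ d,
      show 2 * (r + 1) + d = 2 * r + (d + 1) + 1 by ring]
    ring

theorem evenKernel_add_succ_succ (r d : ℕ) :
    evenKernel (r + d) (r + 2) =
      qfacInv d * qfacInv (2 * r + d + 2) * (1 - X ^ (2 * d)) * (1 - X ^ (2 * (d - 1))) := by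
  rcases d with _ | _ | d
  · rw [evenKernel_of_lt (by omega)]; simp
  · rw [evenKernel_of_lt (by omega)]; simp
  · rw [show r + (d + 1 + 1) = (r + 2) + d by ring, evenKernel_add, qfacInv_succ d,
      qfacInv_succ (d + 1), show 2 * (r + 2) + d = 2 * r + (d + 1 + 1) + 2 by ring,
      -- In the statement the truncated `d - 1` is harmless at `d = 0`, where 1 - q^{2d} vanishes.
      Nat.add_sub_cancel]
    ring

/-! ### Finite triple product -/

/-- The central Gaussian binomial coefficients `[2n; n-j]` in base `q^2`. -/
noncomputable def cbinom (n j : ℕ) : ℤ⟦X⟧ := qfac (2 * n) * evenKernel n j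

theorem cbinom_of_lt {n j : ℕ} (h : n < j) : cbinom n j = 0 := by
  rw [cbinom, evenKernel_of_lt h, mul_zero]

theorem qfac_two_mul_succ (n : ℕ) : qfac (2 * (n + 1)) =
    qfac (2 * n) * (1 - X ^ (2 * (2 * n + 1))) * (1 - X ^ (2 * (2 * n + 2))) := by
  rw [show 2 * (n + 1) = 2 * n + 1 + 1 by ring, qfac_succ, qfac_succ]

theorem cbinom_succ_succ (j d : ℕ) : cbinom (j + d + 1) (j + 1) =
    X ^ (2 * d) * cbinom (j + d) j + (1 + X ^ (2 * (2 * (j + d) + 1))) * cbinom (j + d) (j + 1)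
      + X ^ (2 * (2 * j + d + 2)) * cbinom (j + d) (j + 2) := by
  unfold cbinom
  rw [evenKernel_add, evenKernel_add_succ, evenKernel_add_succ_succ,
    show j + d + 1 = (j + 1) + d by ring, evenKernel_add, show (j + 1) + d = j + d + 1 by ring,
    qfac_two_mul_succ, qfacInv_succ (2 * j + d), qfacInv_succ (2 * j + d + 1),
    show 2 * (j + 1) + d = 2 * j + d + 2 by ring]
  rcases d with _ | d
  · ring
  · rw [Nat.add_sub_cancel]; ring

theorem cbinom_succ_zero (n : ℕ) : cbinom (n + 1) 0 =
    (1 + X ^ (2 * (2 * n + 1))) * cbinom n 0 + 2 * X ^ (2 * (n + 1)) * cbinom n 1 := by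
  unfold cbinom
  have h₀ := evenKernel_add 0 n
  have h₁ := evenKernel_add_succ 0 n
  have h₂ := evenKernel_add 0 (n + 1)
  simp only [Nat.mul_zero, Nat.zero_add] at h₀ h₁ h₂
  rw [h₀, h₁, h₂, qfac_two_mul_succ]
  rw [qfacInv_succ n]
  ring

/-- The terms `(-1)^j q^{j^2} [2n; n-j]` of the finite triple product. -/
noncomputable def tripleTerm (n j : ℕ) : ℤ⟦X⟧ := (-1) ^ j * X ^ (j ^ 2) * cbinom n j

theorem tripleTerm_of_lt {n j : ℕ} (h : n < j) : tripleTerm n j = 0 := by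
  rw [tripleTerm, cbinom_of_lt h, mul_zero]

/-- Coefficient comparison in z for multiplication by (1 - zq^{2n+1})(1 - z⁻¹q^{2n+1}), the step
from n to n + 1 in the two-variable triple product. -/
theorem tripleTerm_succ_succ (n j : ℕ) : tripleTerm (n + 1) (j + 1) =
    (1 + X ^ (4 * n + 2)) * tripleTerm n (j + 1)
      - X ^ (2 * n + 1) * (tripleTerm n j + tripleTerm n (j + 2)) := by
  rcases lt_or_ge n j with h | h
  · rw [tripleTerm_of_lt (by omega), tripleTerm_of_lt (by omega), tripleTerm_of_lt h,
      tripleTerm_of_lt (by omega)]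
    ring
  · obtain ⟨d, rfl⟩ := Nat.exists_eq_add_of_le h
    unfold tripleTerm
    rw [cbinom_succ_succ]
    ring

theorem tripleTerm_succ_zero (n : ℕ) : tripleTerm (n + 1) 0 =
    (1 + X ^ (4 * n + 2)) * tripleTerm n 0 - 2 * X ^ (2 * n + 1) * tripleTerm n 1 := by
  unfold tripleTerm
  rw [cbinom_succ_zero]
  ring

theorem sum_shift_add_shift (s : ℕ → ℤ⟦X⟧) (K : ℕ) :
    ∑ i ∈ Finset.range K, (s i + s (i + 2)) =
      s 0 - s 1 + 2 * ∑ i ∈ Finset.range K, s (i + 1) - s K + s (K + 1) := by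
  induction K with
  | zero => simp
  | succ K ih => rw [Finset.sum_range_succ, ih, Finset.sum_range_succ]; ring

/-- The finite triple product identity. -/
theorem ofac_sq (n K : ℕ) (hK : n ≤ K) : ofac n ^ 2 =
    cbinom n 0 + 2 * ∑ i ∈ Finset.range K, tripleTerm n (i + 1) := by
  have h0 (n) : cbinom n 0 = tripleTerm n 0 := by simp [tripleTerm]
  rw [h0]
  induction n with
  | zero =>
    rw [Finset.sum_eq_zero fun i _ => tripleTerm_of_lt (by omega), ← h0, cbinom, evenKernel,
      ofac_zero]
    simp [qfacInv_zero, qfac_zero]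
  | succ n ih =>
    rw [ofac_succ, mul_pow, ih (by omega), tripleTerm_succ_zero]
    simp_rw [tripleTerm_succ_succ]
    -- The end terms at `K` vanish since `n < K`; the surplus index-1 term cancels the one from
    -- `tripleTerm_succ_zero`, leaving the factor (1 - q^{2n+1})².
    rw [Finset.sum_sub_distrib, ← Finset.mul_sum, ← Finset.mul_sum, sum_shift_add_shift,
      tripleTerm_of_lt (show n < K by omega), tripleTerm_of_lt (show n < K + 1 by omega)]
    ring

/-! ### Hecke-type expansion by telescoping -/

/-- The infinite product `(q^2;q^2)_∞`. -/
noncomputable def qinf : ℤ⟦X⟧ := qPochInf (X ^ 2) (X ^ 2)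

/-- The infinite product `(-q^2;q^2)_∞`. -/
noncomputable def minf : ℤ⟦X⟧ := qPochInf (-X ^ 2) (X ^ 2)

/-- The infinite product `(q;q^2)_∞`. -/
noncomputable def oinf : ℤ⟦X⟧ := qPochInf X (X ^ 2)

theorem qinf_XCong (n : ℕ) : XCong (2 * (n + 1)) qinf (qfac n) :=
  qPochInf_XCong (by simp) ⟨1, by ring⟩

theorem minf_XCong (n : ℕ) : XCong (2 * (n + 1)) minf (mfac n) :=
  qPochInf_XCong (by simp) ⟨-1, by ring⟩

theorem oinf_XCong (n : ℕ) : XCong (2 * n + 1) oinf (ofac n) :=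
  qPochInf_XCong (by simp) ⟨1, by ring⟩

theorem qfac_XCong {n m : ℕ} (h : n ≤ m) : XCong (2 * (n + 1)) (qfac m) (qfac n) :=
  qPoch_XCong ⟨1, by ring⟩ h

theorem constantCoeff_oinf : constantCoeff oinf = 1 := constantCoeff_qPochInf (by simp) (by simp)

/-- The summand `q^{2n} [2n; n-j] / (-q^2;q^2)_n`. -/
noncomputable def gammaTerm (n j : ℕ) : ℤ⟦X⟧ := X ^ (2 * n) * cbinom n j * mfacInv n

/-- The telescoping certificate for `gammaTerm`. -/
noncomputable def gammaCert (n j : ℕ) : ℤ⟦X⟧ :=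
  X ^ (2 * j) * (1 + X ^ (2 * (j + 1))) * cbinom n (j + 1) * mfacInv n

/-- After the common reciprocal factorials are extracted this is a polynomial identity. Summed over
n, it links the values at j and j + 2. -/
theorem gammaTerm_telescope (n j : ℕ) :
    gammaTerm n j + X ^ (2 * (3 * j + 3)) * gammaTerm n (j + 2) =
      gammaCert (n + 1) j - gammaCert n j := by
  unfold gammaTerm gammaCert
  rcases lt_or_ge n j with h | h
  · rw [cbinom_of_lt (by omega), cbinom_of_lt (by omega), cbinom_of_lt (by omega),
      cbinom_of_lt (by omega)]
    ring
  · obtain ⟨d, rfl⟩ := Nat.exists_eq_add_of_le h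
    unfold cbinom
    rw [evenKernel_add, evenKernel_add_succ, evenKernel_add_succ_succ,
      show j + d + 1 = (j + 1) + d by ring, evenKernel_add, show (j + 1) + d = j + d + 1 by ring,
      qfac_two_mul_succ, qfacInv_succ (2 * j + d), qfacInv_succ (2 * j + d + 1),
      show 2 * (j + 1) + d = 2 * j + d + 2 by ring, mfacInv_succ (j + d)]
    rcases d with _ | d
    · ring
    · rw [Nat.add_sub_cancel]; ring

/-- The partial sums `∑_{n<N} q^{2n} [2n; n-j] / (-q^2;q^2)_n`. -/
noncomputable def gammaSum (N j : ℕ) : ℤ⟦X⟧ := ∑ n ∈ Finset.range N, gammaTerm n j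

theorem gammaSum_rec (N j : ℕ) :
    gammaSum N j + X ^ (2 * (3 * j + 3)) * gammaSum N (j + 2) = gammaCert N j := by
  unfold gammaSum
  rw [Finset.mul_sum, ← Finset.sum_add_distrib]
  simp_rw [gammaTerm_telescope]
  rw [Finset.sum_range_sub (fun n => gammaCert n j), gammaCert, gammaCert,
    cbinom_of_lt (Nat.succ_pos j)]
  ring

/-- As N grows, [2N; N-j-1] tends to 1/(q²;q²)_∞ and the other reciprocal to 1/(-q²;q²)_∞. The
factor q^{2j} restores the precision lost through the shift by j. -/
theorem gammaCert_XCong (N j : ℕ) :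
    XCong (2 * N) (qinf * minf * gammaCert N j) (X ^ (2 * j) * (1 + X ^ (2 * (j + 1)))) := by
  rcases lt_or_ge j N with h | h
  · obtain ⟨e, rfl⟩ := Nat.exists_eq_add_of_lt h
    have h₁ : XCong (2 * (e + 1)) (qinf * minf * qfac (2 * (j + e + 1)))
        (qfac e * mfac (j + e + 1) * qfac (2 * (j + 1) + e)) :=
      ((qinf_XCong e).mul ((minf_XCong _).mono (by omega))).mul
        ((qfac_XCong (by omega)).mono (by omega))
    have h₂ := ((h₁.mul_right (qfacInv e * qfacInv (2 * (j + 1) + e) * mfacInv (j + e + 1) *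
      (1 + X ^ (2 * (j + 1))))).X_pow_mul (2 * j)).mono (show 2 * (j + e + 1) ≤ _ by omega)
    refine ((XCong.of_eq ?_).trans h₂).trans (XCong.of_eq ?_)
    · rw [gammaCert, cbinom, show j + e + 1 = j + 1 + e by ring, evenKernel_add]
      ring
    · linear_combination (X ^ (2 * j) * (1 + X ^ (2 * (j + 1))) * (mfac (j + e + 1) *
          mfacInv (j + e + 1)) * (qfac e * qfacInv e)) * qfac_mul_inv (2 * (j + 1) + e)
        + (X ^ (2 * j) * (1 + X ^ (2 * (j + 1))) * (qfac e * qfacInv e)) * mfac_mul_inv (j + e + 1)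
        + (X ^ (2 * j) * (1 + X ^ (2 * (j + 1)))) * qfac_mul_inv e
  · rw [gammaCert, cbinom_of_lt (by omega)]
    simp only [mul_zero, zero_mul]
    exact (XCong.zero_of_dvd ((pow_dvd_pow X (by omega)).mul_right _)).symm

/-- The terms of the partial theta series representing `gammaSum`. -/
noncomputable def partialThetaTerm (j m : ℕ) : ℤ⟦X⟧ :=
  (-1) ^ m * (X ^ (2 * (3 * m ^ 2 + 2 * m + (3 * m + 1) * j))
    * (1 + X ^ (2 * (2 * m + 1 + j))))

theorem gammaSum_XCong_aux (N j K : ℕ) :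
    XCong (2 * N) (qinf * minf * gammaSum N j) (∑ m ∈ Finset.range K, partialThetaTerm j m
      + (-1) ^ K * X ^ (2 * (3 * K ^ 2 + 3 * K * j)) *
        (qinf * minf * gammaSum N (j + 2 * K))) := by
  induction K with
  | zero => exact XCong.of_eq (by simp)
  | succ K ih =>
    refine ih.trans ?_
    have h := (gammaCert_XCong N (j + 2 * K)).mul_left
      ((-1) ^ K * X ^ (2 * (3 * K ^ 2 + 3 * K * j)))
    rw [← gammaSum_rec] at h
    have h' := (h.add (XCong.refl _ (∑ m ∈ Finset.range K, partialThetaTerm j m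
      - (-1) ^ K * X ^ (2 * (3 * K ^ 2 + 3 * K * j)) * (qinf * minf *
        (X ^ (2 * (3 * (j + 2 * K) + 3)) * gammaSum N (j + 2 * K + 2))))))
    refine ((XCong.of_eq ?_).trans h').trans (XCong.of_eq ?_)
    · ring
    · rw [Finset.sum_range_succ, partialThetaTerm, show j + 2 * (K + 1) = j + 2 * K + 2 by ring]
      ring

theorem gammaSum_XCong (N j : ℕ) : XCong (2 * N) (qinf * minf * gammaSum N j)
    (∑ m ∈ Finset.range N, partialThetaTerm j m) := by
  have h := gammaSum_XCong_aux N j N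
  -- After N iterations the index exceeds every n < N, so the remainder vanishes exactly.
  have h0 : gammaSum N (j + 2 * N) = 0 := by
    refine Finset.sum_eq_zero fun n hn => ?_
    have := Finset.mem_range.mp hn
    rw [gammaTerm, cbinom_of_lt (by omega)]
    ring
  rwa [h0, mul_zero, mul_zero, add_zero] at h

/-- The Hecke-type expansion of `(q^4;q^4)_∞ ∑_{n<N} (q;q^2)_n^2 q^{2n} / (-q^2;q^2)_n`. -/
theorem hecke_XCong (N : ℕ) :
    XCong (2 * N) (qinf * minf * ∑ n ∈ Finset.range N, ofac n ^ 2 * X ^ (2 * n) * mfacInv n)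
      (∑ m ∈ Finset.range N, partialThetaTerm 0 m + ∑ i ∈ Finset.range N,
        ∑ m ∈ Finset.range N, 2 * ((-1) ^ (i + 1) * X ^ ((i + 1) ^ 2)
          * partialThetaTerm (i + 1) m)) := by
  have h : qinf * minf * ∑ n ∈ Finset.range N, ofac n ^ 2 * X ^ (2 * n) * mfacInv n =
      qinf * minf * gammaSum N 0 + ∑ i ∈ Finset.range N,
        2 * ((-1) ^ (i + 1) * X ^ ((i + 1) ^ 2)) * (qinf * minf * gammaSum N (i + 1)) := by
    unfold gammaSum
    simp_rw [Finset.mul_sum]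
    rw [Finset.sum_comm, ← Finset.sum_add_distrib]
    refine Finset.sum_congr rfl fun n hn => ?_
    have h' : ∑ i ∈ Finset.range N, 2 * ((-1) ^ (i + 1) * X ^ ((i + 1) ^ 2)) *
        (qinf * minf * gammaTerm n (i + 1)) = qinf * minf * X ^ (2 * n) * mfacInv n * 2 *
          ∑ i ∈ Finset.range N, tripleTerm n (i + 1) := by
      rw [Finset.mul_sum]
      exact Finset.sum_congr rfl fun i _ => by unfold tripleTerm gammaTerm; ring
    rw [ofac_sq n N (Finset.mem_range.mp hn).le, h', gammaTerm]
    ring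
  rw [h]
  refine (gammaSum_XCong N 0).add (XCong.sum fun i _ => ?_)
  refine ((gammaSum_XCong N (i + 1)).mul_left _).trans (XCong.of_eq ?_)
  rw [Finset.mul_sum]
  exact Finset.sum_congr rfl fun m _ => by ring

/-! ### Theta series of squares and supports modulo 8 -/

theorem coeff_neg_one_pow_mul (n k : ℕ) (f : ℤ⟦X⟧) :
    coeff n ((-1) ^ k * f) = (-1) ^ k * coeff n f := by
  rcases neg_one_pow_eq_or ℤ⟦X⟧ k with h | h <;> rcases Nat.even_or_odd k with hk | hk
  all_goals simp [hk.neg_one_pow]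

theorem cbinom_mul_qinf_XCong {N j : ℕ} (h : j ≤ N) :
    XCong (2 * (N - j + 1)) (cbinom N j * qinf) 1 := by
  obtain ⟨d, rfl⟩ := Nat.exists_eq_add_of_le h
  rw [Nat.add_sub_cancel_left]
  have h₁ : XCong (2 * (d + 1)) (qfac (2 * (j + d)) * qinf) (qfac (2 * j + d) * qfac d) :=
    ((qfac_XCong (by omega)).mono (by omega)).mul (qinf_XCong d)
  refine ((XCong.of_eq ?_).trans (h₁.mul_right (qfacInv d * qfacInv (2 * j + d)))).trans
    (XCong.of_eq ?_)
  · rw [cbinom, evenKernel_add]; ring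
  · linear_combination (qfac d * qfacInv d) * qfac_mul_inv (2 * j + d) + qfac_mul_inv d

/-- The truncated theta series `∑_{1≤k≤N} (-1)^k q^{k^2}`. -/
noncomputable def thetaSum (N : ℕ) : ℤ⟦X⟧ :=
  ∑ i ∈ Finset.range N, (-1) ^ (i + 1) * X ^ ((i + 1) ^ 2)

/-- The triple product `(q;q^2)_∞^2 (q^2;q^2)_∞ = ∑_{k∈ℤ} (-1)^k q^{k^2}`, in truncated form. -/
theorem tripleProduct_XCong (N : ℕ) :
    XCong (2 * N) (oinf ^ 2 * qinf) (1 + 2 * thetaSum N) := by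
  have h₁ : XCong (2 * N) (oinf ^ 2 * qinf) (ofac N ^ 2 * qinf) :=
    ((((oinf_XCong N).mono (by omega)).pow 2).mul_right _)
  refine h₁.trans ?_
  rw [ofac_sq N N le_rfl, add_mul, mul_assoc, Finset.sum_mul]
  refine ((cbinom_mul_qinf_XCong (Nat.zero_le N)).mono (by omega)).add
    (XCong.mul_left _ (XCong.sum fun i hi => ?_))
  have hi' : i + 1 ≤ N := Finset.mem_range.mp hi
  -- With k = i + 1, the precision is 2(N - k + 1) + k² ≥ 2N, because (k - 1)² ≥ 0.
  have h₂ := (((cbinom_mul_qinf_XCong hi').X_pow_mul ((i + 1) ^ 2)).mul_left ((-1) ^ (i + 1))).mono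
    (show 2 * N ≤ _ by
      obtain ⟨d, rfl⟩ := Nat.exists_eq_add_of_le hi'
      rw [Nat.add_sub_cancel_left]
      nlinarith [sq_nonneg i])
  refine ((XCong.of_eq ?_).trans h₂).trans (XCong.of_eq ?_)
  · rw [tripleTerm]; ring
  · ring

theorem coeff_thetaSum {n : ℕ} (N : ℕ) (h : ¬ IsSquare n) : coeff n (thetaSum N) = 0 := by
  rw [thetaSum, map_sum]
  refine Finset.sum_eq_zero fun i _ => ?_
  rw [coeff_neg_one_pow_mul, coeff_X_pow, if_neg, mul_zero]
  rintro rfl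
  exact h ⟨i + 1, sq _⟩

/-- Swapping the two factors pairs the terms of the convolution; an odd index has no diagonal term.
-/
theorem even_coeff_sq (f : ℤ⟦X⟧) {n : ℕ} (hn : Odd n) : (2 : ℤ) ∣ coeff n (f ^ 2) := by
  refine mod_cast (ZMod.intCast_zmod_eq_zero_iff_dvd (coeff n (f ^ 2)) 2).mp ?_
  rw [sq, coeff_mul, Int.cast_sum]
  refine Finset.sum_involution (fun a _ => a.swap) ?_ ?_ ?_ ?_
  · intro a _
    rw [Prod.fst_swap, Prod.snd_swap, mul_comm (coeff a.2 f)]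
    exact CharTwo.add_self_eq_zero _
  · rintro ⟨a, b⟩ ha _ h
    have h' : b = a := (Prod.mk.inj h).1
    have ha' : a + b = n := Finset.HasAntidiagonal.mem_antidiagonal.mp ha
    obtain ⟨k, hk⟩ := hn
    omega
  · rintro ⟨a, b⟩ ha
    have ha' : a + b = n := Finset.HasAntidiagonal.mem_antidiagonal.mp ha
    exact Finset.HasAntidiagonal.mem_antidiagonal.mpr ((add_comm b a).trans ha')
  · intro a _
    exact a.swap_swap

/-- The power series whose coefficients vanish at indices `1 (mod 4)` and `4 (mod 8)`, and whose
coefficients of odd index are even. -/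
def heckeSupport : AddSubgroup ℤ⟦X⟧ where
  carrier := {f | ∀ n, (n % 4 = 1 ∨ n % 8 = 4 → coeff n f = 0) ∧ (n % 2 = 1 → (2 : ℤ) ∣ coeff n f)}
  zero_mem' := fun n => by simp
  add_mem' := fun {f g} hf hg n => by
    rw [map_add]
    exact ⟨fun h => by rw [(hf n).1 h, (hg n).1 h, add_zero],
      fun h => dvd_add ((hf n).2 h) ((hg n).2 h)⟩
  neg_mem' := fun {f} hf n => by
    rw [map_neg]
    exact ⟨fun h => by rw [(hf n).1 h, neg_zero], fun h => (dvd_neg).mpr ((hf n).2 h)⟩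

theorem neg_one_pow_mul_mem {G : AddSubgroup ℤ⟦X⟧} {f : ℤ⟦X⟧} (hf : f ∈ G) (k : ℕ) :
    (-1) ^ k * f ∈ G := by
  rcases neg_one_pow_eq_or ℤ⟦X⟧ k with h | h
  · rwa [h, one_mul]
  · rw [h, neg_one_mul]; exact G.neg_mem hf

theorem X_pow_mem_heckeSupport {e : ℕ} (h : e % 8 ≠ 4) (h' : e % 2 = 0) :
    (X ^ e : ℤ⟦X⟧) ∈ heckeSupport := fun n => by
  rw [coeff_X_pow]
  split_ifs with hn
  · subst hn
    exact ⟨by omega, by omega⟩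
  · simp

theorem two_mul_X_pow_mem_heckeSupport {e : ℕ} (h : e % 8 ≠ 4) (h' : e % 4 ≠ 1) :
    (2 * X ^ e : ℤ⟦X⟧) ∈ heckeSupport := fun n => by
  rw [two_mul, map_add, coeff_X_pow]
  split_ifs with hn
  · subst hn
    exact ⟨by omega, fun _ => by norm_num⟩
  · simp

/-- Both exponents of the Hecke sum depend only on j and m mod 8, so 64 cases suffice. -/
theorem hecke_exponent_mod (j m : ℕ) :
    (j ^ 2 + 2 * (3 * m ^ 2 + 2 * m + (3 * m + 1) * j)) % 8 ∉ ({1, 4, 5} : Finset ℕ) ∧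
    (j ^ 2 + 2 * (3 * m ^ 2 + 2 * m + (3 * m + 1) * j) + 2 * (2 * m + 1 + j)) % 8 ∉
      ({1, 4, 5} : Finset ℕ) := by
  have key : ∀ a b : Fin 8, (a.val ^ 2 + 2 * (3 * b.val ^ 2 + 2 * b.val + (3 * b.val + 1) * a.val)) % 8
      ∉ ({1, 4, 5} : Finset ℕ) ∧ (a.val ^ 2 + 2 * (3 * b.val ^ 2 + 2 * b.val
        + (3 * b.val + 1) * a.val) + 2 * (2 * b.val + 1 + a.val)) % 8 ∉ ({1, 4, 5} : Finset ℕ) := by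
    decide
  have h := key ⟨j % 8, Nat.mod_lt _ (by norm_num)⟩ ⟨m % 8, Nat.mod_lt _ (by norm_num)⟩
  have hj : j % 8 ≡ j [MOD 8] := Nat.mod_modEq j 8
  have hm : m % 8 ≡ m [MOD 8] := Nat.mod_modEq m 8
  have e₁ : (j % 8) ^ 2 + 2 * (3 * (m % 8) ^ 2 + 2 * (m % 8) + (3 * (m % 8) + 1) * (j % 8)) ≡
      j ^ 2 + 2 * (3 * m ^ 2 + 2 * m + (3 * m + 1) * j) [MOD 8] := by gcongr
  have e₂ : 2 * (2 * (m % 8) + 1 + (j % 8)) ≡ 2 * (2 * m + 1 + j) [MOD 8] := by gcongr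
  rw [← e₁, ← e₁.add e₂]
  exact h

theorem partialThetaTerm_mem (m : ℕ) : partialThetaTerm 0 m ∈ heckeSupport := by
  have h := hecke_exponent_mod 0 m
  simp only [Finset.mem_insert, Finset.mem_singleton, not_or] at h
  rw [partialThetaTerm]
  refine neg_one_pow_mul_mem ?_ m
  rw [mul_add, mul_one, ← pow_add]
  refine add_mem (X_pow_mem_heckeSupport ?_ ?_) (X_pow_mem_heckeSupport ?_ ?_)
  · simpa using h.1.2.1
  · omega
  · simpa using h.2.2.1
  · omega

theorem two_mul_partialThetaTerm_mem (j m : ℕ) :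
    2 * ((-1) ^ j * X ^ (j ^ 2) * partialThetaTerm j m) ∈ heckeSupport := by
  have h := hecke_exponent_mod j m
  simp only [Finset.mem_insert, Finset.mem_singleton, not_or] at h
  have e : 2 * ((-1) ^ j * X ^ (j ^ 2) * partialThetaTerm j m) = (-1) ^ (j + m) *
      (2 * X ^ (j ^ 2 + 2 * (3 * m ^ 2 + 2 * m + (3 * m + 1) * j)) + 2 * X ^ (j ^ 2 +
        2 * (3 * m ^ 2 + 2 * m + (3 * m + 1) * j) + 2 * (2 * m + 1 + j))) := by
    rw [partialThetaTerm]; ring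
  rw [e]
  refine neg_one_pow_mul_mem (add_mem (two_mul_X_pow_mem_heckeSupport ?_ ?_)
    (two_mul_X_pow_mem_heckeSupport ?_ ?_)) _ <;> omega

/-! ### The congruence for c modulo 8 -/

/-- Each infinite product in the summand is a tail, that is, the full product divided by its first n
factors. -/
theorem CTerm_mul (n : ℕ) :
    CTerm n * oinf ^ 2 = X * (minf * (ofac n ^ 2 * X ^ (2 * n) * mfacInv n)) := by
  have h₁ : minf = mfac n * qPochInf (-X ^ (2 * n + 2)) (X ^ 2) := by
    rw [minf, qPochInf_split (by simp) n, mfac]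
    congr 2
    ring
  have h₂ : oinf = ofac n * qPochInf (X ^ (2 * n + 1)) (X ^ 2) := by
    rw [oinf, qPochInf_split (by simp) n, ofac]
    congr 2
    ring
  have h₃ : constantCoeff (qPochInf (X ^ (2 * n + 1)) (X ^ 2) ^ 2) = 1 := by
    rw [map_pow, constantCoeff_qPochInf (by simp) (by simp), one_pow]
  rw [CTerm, h₁, h₂]
  linear_combination (qPochInf (-X ^ (2 * n + 2)) (X ^ 2) * X ^ (2 * n + 1) * ofac n ^ 2)
    * (mul_recip h₃ - mfac_mul_inv n)

theorem CSeries_XCong (N : ℕ) : XCong N (CSeries * (oinf ^ 2 * qinf))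
    (X * (qinf * minf * ∑ n ∈ Finset.range N, ofac n ^ 2 * X ^ (2 * n) * mfacInv n)) := by
  have h : XCong N CSeries (∑ n ∈ Finset.range N, CTerm n) :=
    tsum_XCong (fun n => Dvd.dvd.mul_right (Dvd.dvd.mul_left (pow_dvd_pow X (by omega)) _) _) _
  refine (h.mul_right _).trans (XCong.of_eq ?_)
  rw [Finset.sum_mul, Finset.mul_sum, Finset.mul_sum]
  refine Finset.sum_congr rfl fun n _ => ?_
  rw [← mul_assoc, CTerm_mul]
  ring

/-- Removing a square, which is 0, 1 or 4 mod 8, from 8n + 5 leaves 5, 4 or 1 mod 8, where f has no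
coefficient. -/
theorem coeff_mul_thetaSum {f : ℤ⟦X⟧} (hf : f ∈ heckeSupport) (N n : ℕ) :
    coeff (8 * n + 5) (f * thetaSum N) = 0 := by
  rw [coeff_mul]
  refine Finset.sum_eq_zero fun a ha => ?_
  rw [Finset.HasAntidiagonal.mem_antidiagonal] at ha
  by_cases hs : IsSquare a.2
  · obtain ⟨k, hk⟩ := hs
    have hk' : a.2 % 8 = 0 ∨ a.2 % 8 = 1 ∨ a.2 % 8 = 4 := by
      have : k % 8 < 8 := Nat.mod_lt _ (by norm_num)
      rw [hk, Nat.mul_mod]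
      interval_cases k % 8 <;> simp
    rw [(hf a.1).1 (by omega), zero_mul]
  · rw [coeff_thetaSum N hs, mul_zero]

theorem even_coeff_mul_sq {f : ℤ⟦X⟧} (hf : f ∈ heckeSupport) (g : ℤ⟦X⟧) {n : ℕ} (hn : Odd n) :
    (2 : ℤ) ∣ coeff n (f * g ^ 2) := by
  rw [coeff_mul]
  refine Finset.dvd_sum fun a ha => ?_
  rw [Finset.HasAntidiagonal.mem_antidiagonal] at ha
  rcases Nat.even_or_odd a.1 with h | h
  · refine Dvd.dvd.mul_left (even_coeff_sq g ?_) _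
    rw [← ha] at hn
    exact (Nat.odd_add'.mp hn).mpr h
  · exact Dvd.dvd.mul_right ((hf a.1).2 (Nat.odd_iff.mp h)) _

theorem c_modEq (n : ℕ) : c (8 * n + 6) ≡ 0 [ZMOD 8] := by
  obtain ⟨N, hN⟩ : ∃ N, N = 8 * n + 7 := ⟨_, rfl⟩
  set V : ℤ⟦X⟧ := ∑ m ∈ Finset.range N, partialThetaTerm 0 m + ∑ i ∈ Finset.range N,
    ∑ m ∈ Finset.range N, 2 * ((-1) ^ (i + 1) * X ^ ((i + 1) ^ 2) * partialThetaTerm (i + 1) m)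
    with hVdef
  have hV : V ∈ heckeSupport := add_mem (sum_mem fun m _ => partialThetaTerm_mem m)
    (sum_mem fun i _ => sum_mem fun m _ => two_mul_partialThetaTerm_mem (i + 1) m)
  have h₁ : XCong N (CSeries * (1 + 2 * thetaSum N)) (X * V) :=
    ((((tripleProduct_XCong N).mono (by omega)).mul_left CSeries).symm.trans
      (CSeries_XCong N)).trans (((hecke_XCong N).mono (by omega)).mul_left X)
  -- This factor inverts 1 + 2θ modulo 8, the product being 1 + 8θ³.
  have h₂ := (h₁.mul_right (1 - 2 * thetaSum N + 4 * thetaSum N ^ 2)).coeff_eq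
    (show 8 * n + 5 + 1 < N by omega)
  have e₁ : CSeries * (1 + 2 * thetaSum N) * (1 - 2 * thetaSum N + 4 * thetaSum N ^ 2) =
      CSeries + 8 * (CSeries * thetaSum N ^ 3) := by ring
  have e₂ : X * V * (1 - 2 * thetaSum N + 4 * thetaSum N ^ 2) =
      X * (V + 4 * (V * thetaSum N ^ 2) - 2 * (V * thetaSum N)) := by ring
  have hc (k : ℕ) (z : ℕ) (f : ℤ⟦X⟧) : coeff k ((z : ℤ⟦X⟧) * f) = z * coeff k f := by
    rw [← nsmul_eq_mul, map_nsmul, nsmul_eq_mul]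
  have h8 := hc (8 * n + 5 + 1) 8 (CSeries * thetaSum N ^ 3)
  have h4 := hc (8 * n + 5) 4 (V * thetaSum N ^ 2)
  have h2 := hc (8 * n + 5) 2 (V * thetaSum N)
  push_cast at h8 h4 h2
  rw [e₁, e₂, coeff_succ_X_mul, map_sub, map_add, map_add, h8, h4, h2, coeff_mul_thetaSum hV,
    (hV (8 * n + 5)).1 (by omega)] at h₂
  obtain ⟨t, ht⟩ := even_coeff_mul_sq hV (thetaSum N) (n := 8 * n + 5) ⟨4 * n + 2, by ring⟩
  rw [ht] at h₂
  refine (Int.modEq_zero_iff_dvd).mpr ⟨t - coeff (8 * n + 5 + 1) (CSeries * thetaSum N ^ 3), ?_⟩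
  rw [c]
  linarith

/-! ### Summation of the kernel against B -/

theorem oddKernel_add_succ (r d : ℕ) :
    oddKernel (r + d) (r + 1) = qfacInv d * qfacInv (2 * r + d + 2) * (1 - X ^ (2 * d)) := by
  rcases d with _ | d
  · rw [oddKernel_of_lt (by omega)]; simp
  · rw [show r + (d + 1) = (r + 1) + d by ring, oddKernel_add, qfacInv_succ d,
      show 2 * (r + 1) + d + 1 = 2 * r + (d + 1) + 2 by ring]
    ring

/-- The summand `(-q^2;q^2)_n q^{n(n+1)} / ((q^2;q^2)_{n-r} (q^2;q^2)_{n+r+1})`. -/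
noncomputable def deltaTerm (n r : ℕ) : ℤ⟦X⟧ := mfac n * X ^ (n * (n + 1)) * oddKernel n r

/-- The telescoping certificate for `deltaTerm`. -/
noncomputable def deltaCert (n r : ℕ) : ℤ⟦X⟧ :=
  (1 - X ^ (2 * (r + 1))) * (mfac n * X ^ (n * (n + 1)) * evenKernel n (r + 1))

theorem deltaTerm_telescope (n r : ℕ) :
    X ^ (2 * (r + 1)) * deltaTerm n r - deltaTerm n (r + 1) =
      deltaCert (n + 1) r - deltaCert n r := by
  unfold deltaTerm deltaCert
  rcases lt_or_ge n r with h | h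
  · rw [oddKernel_of_lt h, oddKernel_of_lt (by omega), evenKernel_of_lt (by omega),
      evenKernel_of_lt (by omega)]
    ring
  · obtain ⟨d, rfl⟩ := Nat.exists_eq_add_of_le h
    rw [oddKernel_add, oddKernel_add_succ, evenKernel_add_succ, mfac_succ,
      show r + d + 1 = (r + 1) + d by ring, evenKernel_add, show (r + 1) + d = r + d + 1 by ring,
      qfacInv_succ (2 * r + d + 1), show 2 * (r + 1) + d = 2 * r + d + 1 + 1 by ring]
    ring

/-- The partial sums `∑_{n<N} (-q^2;q^2)_n q^{n(n+1)} / ((q^2;q^2)_{n-r} (q^2;q^2)_{n+r+1})`. -/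
noncomputable def deltaSum (N r : ℕ) : ℤ⟦X⟧ := ∑ n ∈ Finset.range N, deltaTerm n r

theorem deltaSum_rec (N r : ℕ) :
    X ^ (2 * (r + 1)) * deltaSum N r - deltaSum N (r + 1) = deltaCert N r := by
  unfold deltaSum
  rw [Finset.mul_sum, ← Finset.sum_sub_distrib]
  simp_rw [deltaTerm_telescope]
  rw [Finset.sum_range_sub (fun n => deltaCert n r), deltaCert, deltaCert,
    evenKernel_of_lt (Nat.succ_pos r)]
  ring

/-- The boundary term of the telescoped sum carries q^{N(N+1)}, so the recurrence in r is
homogeneous to that order. -/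
theorem deltaSum_XCong_zero (N r : ℕ) :
    XCong (N * (N + 1)) (deltaSum N r) (X ^ (r * (r + 1)) * deltaSum N 0) := by
  induction r with
  | zero => exact XCong.of_eq (by simp)
  | succ r ih =>
    have h : XCong (N * (N + 1)) (deltaCert N r) 0 :=
      XCong.zero_of_dvd (((dvd_mul_left _ _).mul_right _).mul_left _)
    rw [← deltaSum_rec] at h
    have h' := (ih.mul_left (X ^ (2 * (r + 1)))).sub h
    refine ((XCong.of_eq ?_).trans h').trans (XCong.of_eq ?_) <;> ring

/-- Comparison with r = K, where only the summand n = K survives, evaluates the sum at 0. Cancelling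
q^{K(K+1)} from precision (K+1)(K+2) leaves 2(K+1). -/
theorem deltaSum_zero_XCong (K : ℕ) :
    XCong (2 * (K + 1)) (deltaSum (K + 1) 0) (mfac K * qfacInv (2 * K + 1)) := by
  have h := deltaSum_XCong_zero (K + 1) K
  rw [show (K + 1) * (K + 1 + 1) = 2 * (K + 1) + K * (K + 1) by ring] at h
  refine (XCong.of_X_pow_mul (h.symm.trans (XCong.of_eq ?_)))
  have h0 : oddKernel K K = qfacInv 0 * qfacInv (2 * K + 0 + 1) := oddKernel_add K 0
  rw [deltaSum, Finset.sum_range_succ, Finset.sum_eq_zero fun n hn => by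
    rw [deltaTerm, oddKernel_of_lt (Finset.mem_range.mp hn), mul_zero], deltaTerm, h0, qfacInv_zero]
  ring

theorem qinf_mul_deltaSum_XCong (K r : ℕ) :
    XCong (2 * (K + 1)) (qinf * deltaSum (K + 1) r) (minf * X ^ (r * (r + 1))) := by
  have h₁ : XCong (2 * (K + 1)) (qinf * deltaSum (K + 1) 0) minf := by
    refine (((qinf_XCong (2 * K + 1)).mono (by omega)).mul (deltaSum_zero_XCong K)).trans ?_
    refine (XCong.of_eq ?_).trans (minf_XCong K).symm
    linear_combination mfac K * qfac_mul_inv (2 * K + 1)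
  have h₂ := ((deltaSum_XCong_zero (K + 1) r).mono (show 2 * (K + 1) ≤ _ by nlinarith)).mul_left qinf
  refine (h₂.trans (XCong.of_eq ?_)).trans (h₁.mul_right (X ^ (r * (r + 1))))
  ring

/-! ### Partial fractions and the Appell-Lerch form of B -/

/-- The factor `(1+q^{2r+1}) / (1-q^{2r+1})`. -/
noncomputable def cayley (r : ℕ) : ℤ⟦X⟧ := (1 + X ^ (2 * r + 1)) * recip (1 - X ^ (2 * r + 1))

theorem mul_recip_one_sub (r : ℕ) :
    (1 - X ^ (2 * r + 1) : ℤ⟦X⟧) * recip (1 - X ^ (2 * r + 1)) = 1 := mul_recip (by simp)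

/-- The telescoping certificate for the partial fraction expansion of `1 / (q;q^2)_n^2`. -/
noncomputable def fractionCert (n r : ℕ) : ℤ⟦X⟧ :=
  (-1) ^ r * X ^ (r * (r + 1) + 2 * (n - r)) * (1 - X ^ (2 * r)) * evenKernel n r

theorem oddKernel_pred {n r d : ℕ} (h : n + 1 = r + d) : oddKernel n r =
    oddKernel (n + 1) r * (1 - X ^ (2 * d)) * (1 - X ^ (2 * (2 * r + d + 1))) := by
  rcases d with _ | d
  · rw [oddKernel_of_lt (by omega)]; simp
  · rw [h, oddKernel_add, show n = r + d by omega, oddKernel_add, qfacInv_succ d,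
      qfacInv_succ (2 * r + d + 1), show 2 * r + (d + 1) + 1 = 2 * r + d + 1 + 1 by ring]
    ring

/-- With n + 1 = r + d, (1 - q^{2n+3})² - (1 - q^{2d})(1 - q^{2(2r+d+1)}) = q^{2d}(1 - q^{2r+1})²,
which clears the denominator of `cayley r`. -/
theorem fraction_telescope {n r : ℕ} (h : r ≤ n + 1) :
    (1 - X ^ (2 * (n + 1))) * ((-1) ^ r * X ^ (r * (r + 1)) * cayley r *
      (oddKernel (n + 1) r * (1 - X ^ (2 * (n + 1) + 1)) ^ 2 - oddKernel n r)) =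
      fractionCert (n + 1) r - fractionCert (n + 1) (r + 1) := by
  obtain ⟨d, hd⟩ := Nat.exists_eq_add_of_le h
  have e : cayley r * (1 - X ^ (2 * r + 1)) ^ 2 = 1 - X ^ (4 * r + 2) := by
    rw [cayley]
    linear_combination (1 - X ^ (4 * r + 2)) * mul_recip_one_sub r
  have e' : cayley r * (oddKernel (n + 1) r * (1 - X ^ (2 * (n + 1) + 1)) ^ 2 - oddKernel n r) =
      X ^ (2 * d) * (1 - X ^ (4 * r + 2)) * oddKernel (n + 1) r := by
    rw [oddKernel_pred hd, ← e, hd]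
    ring
  rw [mul_assoc _ (cayley r), e', fractionCert, fractionCert, hd, evenKernel_add,
    evenKernel_add_succ, oddKernel_add, qfacInv_succ (2 * r + d)]
  rcases d with _ | d
  · simp only [Nat.add_sub_cancel_left]; ring
  · rw [Nat.add_sub_cancel_left, show r + (d + 1) - (r + 1) = d by omega]
    ring

theorem fraction_expansion (n : ℕ) : recip (ofac (n + 1) ^ 2) =
    ∑ r ∈ Finset.range (n + 1), (-1) ^ r * X ^ (r * (r + 1)) * cayley r * oddKernel n r := by
  refine recip_eq_of_mul_eq_one (by rw [map_pow, constantCoeff_ofac, one_pow]) ?_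
  induction n with
  | zero =>
    have h0 : oddKernel 0 0 = qfacInv 0 * qfacInv (2 * 0 + 0 + 1) := oddKernel_add 0 0
    have h1 := qfacInv_succ 0
    have h2 := mul_recip_one_sub 0
    rw [qfacInv_zero] at h0 h1
    simp only [Nat.mul_zero, Nat.zero_add, pow_one, mul_one] at h0 h1 h2
    rw [ofac_succ, ofac_zero, Finset.sum_range_one, h0, cayley]
    simp only [Nat.mul_zero, Nat.zero_add, pow_one, pow_zero, one_mul, zero_mul]
    linear_combination (1 - X ^ 2) * qfacInv 1 * h2 - h1
  | succ n ih =>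
    have key : (∑ r ∈ Finset.range (n + 2), (-1) ^ r * X ^ (r * (r + 1)) * cayley r *
        oddKernel (n + 1) r) * (1 - X ^ (2 * (n + 1) + 1)) ^ 2 =
        ∑ r ∈ Finset.range (n + 1), (-1) ^ r * X ^ (r * (r + 1)) * cayley r * oddKernel n r := by
      have h0 : ∑ r ∈ Finset.range (n + 1), (-1) ^ r * X ^ (r * (r + 1)) * cayley r * oddKernel n r
          = ∑ r ∈ Finset.range (n + 2), (-1) ^ r * X ^ (r * (r + 1)) * cayley r * oddKernel n r := by
        rw [Finset.sum_range_succ _ (n + 1), oddKernel_of_lt n.lt_succ_self, mul_zero, add_zero]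
      rw [h0, ← sub_eq_zero]
      refine eq_of_mul_eq (u := 1 - X ^ (2 * (n + 1))) (by simp) ?_
      rw [Finset.sum_mul, ← Finset.sum_sub_distrib, Finset.mul_sum, mul_zero]
      -- The certificate vanishes at both ends: at r = 0 through 1 - q^{2r}, at r = n + 2 through
      -- the kernel.
      rw [Finset.sum_congr rfl fun r hr => (?_ : _ = fractionCert (n + 1) r
        - fractionCert (n + 1) (r + 1)), Finset.sum_range_sub', fractionCert, fractionCert,
        evenKernel_of_lt (show n + 1 < n + 2 by omega)]
      · simp
      · rw [← fraction_telescope (Nat.lt_succ_iff.mp (Finset.mem_range.mp hr))]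
        ring
    rw [← key] at ih
    rw [ofac_succ, mul_pow]
    linear_combination ih

theorem BTerm_eq {n N : ℕ} (h : n < N) : BTerm n =
    ∑ r ∈ Finset.range N, (-1) ^ r * X ^ (r * (r + 1)) * cayley r * deltaTerm n r := by
  have hs : Finset.range (n + 1) ⊆ Finset.range N := Finset.range_subset_range.mpr h
  rw [← Finset.sum_subset hs fun r _ hr => by
    rw [Finset.mem_range, not_lt] at hr
    rw [deltaTerm, oddKernel_of_lt hr, mul_zero, mul_zero]]
  have e : BTerm n = mfac n * X ^ (n * (n + 1)) * recip (ofac (n + 1) ^ 2) := rfl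
  rw [e, fraction_expansion, Finset.mul_sum]
  exact Finset.sum_congr rfl fun r _ => by rw [deltaTerm]; ring

/-- The expansion `(q^2;q^2)_∞ B(q) = (-q^2;q^2)_∞ ∑_r (-1)^r q^{2r(r+1)} (1+q^{2r+1})/(1-q^{2r+1})`,
in truncated form. -/
theorem BSeries_XCong (N : ℕ) : XCong N (qinf * BSeries)
    (minf * ∑ r ∈ Finset.range N, (-1) ^ r * X ^ (2 * (r * (r + 1))) * cayley r) := by
  rcases N with _ | K
  · exact ⟨_, (one_mul _).symm⟩
  have h : XCong (K + 1) BSeries (∑ n ∈ Finset.range (K + 1), BTerm n) :=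
    tsum_XCong (fun n => Dvd.dvd.mul_right (Dvd.dvd.mul_left (pow_dvd_pow X (by nlinarith)) _) _) _
  refine (h.mul_left qinf).trans ?_
  have e : qinf * ∑ n ∈ Finset.range (K + 1), BTerm n = ∑ r ∈ Finset.range (K + 1),
      (-1) ^ r * X ^ (r * (r + 1)) * cayley r * (qinf * deltaSum (K + 1) r) := by
    rw [Finset.sum_congr rfl fun n hn => BTerm_eq (Finset.mem_range.mp hn), Finset.sum_comm,
      Finset.mul_sum]
    refine Finset.sum_congr rfl fun r _ => ?_
    rw [← Finset.mul_sum, deltaSum]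
    ring
  rw [e, Finset.mul_sum]
  refine XCong.sum fun r _ => ?_
  refine (((qinf_mul_deltaSum_XCong K r).mono (by omega)).mul_left _).trans (XCong.of_eq ?_)
  ring

/-! ### Windmill involutions for x² + 2yz = n -/

theorem card_eq_card_fixed {α : Type*} [DecidableEq α] (s : Finset α) (f : α → α)
    (hf : ∀ a ∈ s, f a ∈ s) (hff : ∀ a ∈ s, f (f a) = a) :
    (s.card : ZMod 2) = (s.filter fun a => f a = a).card := by
  rw [← Finset.card_filter_add_card_filter_not (fun a => f a = a), Nat.cast_add, add_eq_left,
    Finset.card_eq_sum_ones, Nat.cast_sum]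
  refine Finset.sum_involution (fun a _ => f a) (fun a _ => by decide) ?_ ?_ ?_
  · intro a ha _
    exact (Finset.mem_filter.mp ha).2
  · intro a ha
    obtain ⟨h₁, h₂⟩ := Finset.mem_filter.mp ha
    refine Finset.mem_filter.mpr ⟨hf a h₁, fun h => h₂ ?_⟩
    rw [hff a h₁] at h
    exact h.symm
  · intro a ha
    exact hff a (Finset.mem_filter.mp ha).1

/-- The positive integer solutions of `x^2 + 2yz = n`. -/
noncomputable def windmills (n : ℤ) : Finset (ℤ × ℤ × ℤ) :=
  (Finset.Icc 1 n ×ˢ Finset.Icc 1 n ×ˢ Finset.Icc 1 n).filter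
    fun a => a.1 ^ 2 + 2 * a.2.1 * a.2.2 = n

theorem mem_windmills {n x y z : ℤ} :
    (x, y, z) ∈ windmills n ↔ 0 < x ∧ 0 < y ∧ 0 < z ∧ x ^ 2 + 2 * y * z = n := by
  simp only [windmills, Finset.mem_filter, Finset.mem_product, Finset.mem_Icc]
  constructor
  · rintro ⟨⟨⟨_, _⟩, ⟨_, _⟩, _, _⟩, h⟩
    exact ⟨by omega, by omega, by omega, h⟩
  · rintro ⟨hx, hy, hz, h⟩
    refine ⟨⟨⟨by omega, ?_⟩, ⟨by omega, ?_⟩, by omega, ?_⟩, h⟩ <;>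
      nlinarith [mul_pos hy hz, sq_nonneg x, mul_pos hx hx, mul_nonneg hx.le hx.le]

/-- Jackson's involution on `windmills n`. -/
def windmillFlip (a : ℤ × ℤ × ℤ) : ℤ × ℤ × ℤ :=
  let x := a.1; let y := a.2.1; let z := a.2.2
  if 2 * y < x then (x - 2 * y, z + 2 * x - 2 * y, y)
  else if 2 * y < 2 * x + z then (2 * y - x, y, 2 * x - 2 * y + z)
  else if 2 * y < 3 * x + 2 * z then (3 * x - 2 * y + 2 * z, 2 * x - y + 2 * z, -2 * x + 2 * y - z)
  else if y < 2 * x + 2 * z then (-3 * x + 2 * y - 2 * z, -2 * x + 2 * y - z, 2 * x - y + 2 * z)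
  else (x + 2 * z, z, -2 * x + y - 2 * z)

theorem windmillFlip_cases (x y z : ℤ) :
    (2 * y < x ∧ windmillFlip (x, y, z) = (x - 2 * y, z + 2 * x - 2 * y, y)) ∨
    (x ≤ 2 * y ∧ 2 * y < 2 * x + z ∧
      windmillFlip (x, y, z) = (2 * y - x, y, 2 * x - 2 * y + z)) ∨
    (x ≤ 2 * y ∧ 2 * x + z ≤ 2 * y ∧ 2 * y < 3 * x + 2 * z ∧ windmillFlip (x, y, z) =
      (3 * x - 2 * y + 2 * z, 2 * x - y + 2 * z, -2 * x + 2 * y - z)) ∨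
    (x ≤ 2 * y ∧ 2 * x + z ≤ 2 * y ∧ 3 * x + 2 * z ≤ 2 * y ∧ y < 2 * x + 2 * z ∧
      windmillFlip (x, y, z) =
        (-3 * x + 2 * y - 2 * z, -2 * x + 2 * y - z, 2 * x - y + 2 * z)) ∨
    (x ≤ 2 * y ∧ 2 * x + z ≤ 2 * y ∧ 3 * x + 2 * z ≤ 2 * y ∧ 2 * x + 2 * z ≤ y ∧
      windmillFlip (x, y, z) = (x + 2 * z, z, -2 * x + y - 2 * z)) := by
  simp only [windmillFlip]
  split_ifs with h₁ h₂ h₃ h₄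
  · exact Or.inl ⟨h₁, rfl⟩
  · exact Or.inr (Or.inl ⟨by omega, h₂, rfl⟩)
  · exact Or.inr (Or.inr (Or.inl ⟨by omega, by omega, h₃, rfl⟩))
  · exact Or.inr (Or.inr (Or.inr (Or.inl ⟨by omega, by omega, by omega, h₄, rfl⟩)))
  · exact Or.inr (Or.inr (Or.inr (Or.inr ⟨by omega, by omega, by omega, by omega, rfl⟩)))

theorem sq_emod_eight (t : ℤ) : t ^ 2 % 8 = 0 ∨ t ^ 2 % 8 = 1 ∨ t ^ 2 % 8 = 4 := by
  have h : t % 8 < 8 := Int.emod_lt_of_pos t (by norm_num)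
  have h' : 0 ≤ t % 8 := Int.emod_nonneg t (by norm_num)
  rw [pow_two, Int.mul_emod]
  interval_cases t % 8 <;> simp

/-- Each excluded equality makes n a square, a sum of two squares, or a² - 2b², never 3 mod 8. The
first two, with x odd, keep `windmillFlip` off the region boundaries where an entry would vanish;
the last two rule out fixed points in its third and fourth regions. -/
theorem windmill_generic {n x y z : ℤ} (hn : n % 8 = 3) (h : x ^ 2 + 2 * y * z = n) :
    x % 2 = 1 ∧ 2 * y ≠ 2 * x + z ∧ y ≠ 2 * x + 2 * z ∧ y ≠ x + z ∧ y ≠ 2 * x + z := by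
  refine ⟨?_, ?_, ?_, ?_, ?_⟩
  · rcases Int.emod_two_eq_zero_or_one x with h0 | h0
    · obtain ⟨k, rfl⟩ := Int.dvd_of_emod_eq_zero h0
      have : n = 2 * (2 * k ^ 2 + y * z) := by rw [← h]; ring
      omega
    · exact h0
  · intro e
    have : n = (x + z) ^ 2 := by rw [← h, e]; ring
    have := sq_emod_eight (x + z)
    omega
  · intro e
    have : n = (x + 2 * z) ^ 2 := by rw [← h, e]; ring
    have := sq_emod_eight (x + 2 * z)
    omega
  · intro e
    have : n = (x + z) ^ 2 + z ^ 2 := by rw [← h, e]; ring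
    have := sq_emod_eight (x + z)
    have := sq_emod_eight z
    omega
  · intro e
    have : n = (x + 2 * z) ^ 2 - 2 * z ^ 2 := by rw [← h, e]; ring
    have := sq_emod_eight (x + 2 * z)
    have := sq_emod_eight z
    omega

theorem windmillFlip_mem {n : ℤ} (hn : n % 8 = 3) (a : ℤ × ℤ × ℤ) (ha : a ∈ windmills n) :
    windmillFlip a ∈ windmills n := by
  obtain ⟨x, y, z⟩ := a
  obtain ⟨hx, hy, hz, h⟩ := mem_windmills.mp ha
  obtain ⟨h₁, h₂, h₃, -, -⟩ := windmill_generic hn h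
  simp only [windmillFlip]
  split_ifs <;>
    exact mem_windmills.mpr ⟨by omega, by omega, by omega, by linear_combination h⟩

theorem windmillFlip_flip {n : ℤ} (hn : n % 8 = 3) (a : ℤ × ℤ × ℤ) (ha : a ∈ windmills n) :
    windmillFlip (windmillFlip a) = a := by
  obtain ⟨x, y, z⟩ := a
  obtain ⟨hx, hy, hz, h⟩ := mem_windmills.mp ha
  obtain ⟨h₁, h₂, h₃, -, -⟩ := windmill_generic hn h
  obtain ⟨⟨x', y', z'⟩, ha'⟩ : ∃ a', windmillFlip (x, y, z) = a' := ⟨_, rfl⟩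
  rw [ha']
  rcases windmillFlip_cases x y z with ⟨_, e⟩ | ⟨_, _, e⟩ | ⟨_, _, _, e⟩ | ⟨_, _, _, _, e⟩ |
    ⟨_, _, _, _, e⟩ <;> rw [ha', Prod.mk.injEq, Prod.mk.injEq] at e <;>
  rcases windmillFlip_cases x' y' z' with ⟨_, e'⟩ | ⟨_, _, e'⟩ | ⟨_, _, _, e'⟩ |
    ⟨_, _, _, _, e'⟩ | ⟨_, _, _, _, e'⟩ <;> rw [e', Prod.mk.injEq, Prod.mk.injEq] <;> omega

theorem windmillFlip_fixed {n x y z : ℤ} (hn : n % 8 = 3) (ha : (x, y, z) ∈ windmills n) :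
    windmillFlip (x, y, z) = (x, y, z) ↔ y = x := by
  obtain ⟨hx, hy, hz, h⟩ := mem_windmills.mp ha
  obtain ⟨h₁, h₂, h₃, h₄, h₅⟩ := windmill_generic hn h
  rcases windmillFlip_cases x y z with ⟨_, e⟩ | ⟨_, _, e⟩ | ⟨_, _, _, e⟩ | ⟨_, _, _, _, e⟩ |
    ⟨_, _, _, _, e⟩ <;> rw [e, Prod.mk.injEq, Prod.mk.injEq] <;> omega

/-- For `m ≡ 1 (mod 4)`, the representations `2m + 1 = x^2 + 2y^2` and the factorisations of
`2m + 1` are equinumerous modulo `2`. -/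
theorem card_sq_rep_eq_card_factor {m N : ℕ} (hm : m % 4 = 1) (hN : m ≤ N) :
    ((((Finset.range N ×ˢ Finset.range N).filter
      fun a => 2 * (a.1 * (a.1 + 1)) + (a.2 + 1) ^ 2 = m).card : ℕ) : ZMod 2) =
    (((Finset.range N ×ˢ Finset.range N).filter
      fun a => 2 * (a.1 * (a.1 + 1)) + (2 * a.1 + 1) * (a.2 + 1) = m).card : ℕ) := by
  obtain ⟨n, hnm⟩ : ∃ n : ℤ, n = 2 * m + 1 := ⟨_, rfl⟩
  have hn : n % 8 = 3 := by omega
  have h₁ : ((Finset.range N ×ˢ Finset.range N).filter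
      fun a => 2 * (a.1 * (a.1 + 1)) + (a.2 + 1) ^ 2 = m).card =
      ((windmills n).filter fun a => (a.1, a.2.2, a.2.1) = a).card := by
    refine Finset.card_bij (fun a _ => ((2 * a.1 + 1 : ℤ), (a.2 + 1 : ℤ), (a.2 + 1 : ℤ))) ?_ ?_ ?_
    · rintro ⟨r, i⟩ ha
      have h := (Finset.mem_filter.mp ha).2
      zify at h
      refine Finset.mem_filter.mpr ⟨mem_windmills.mpr ⟨by positivity, by positivity, by positivity,
        ?_⟩, rfl⟩
      simp only at h ⊢
      linear_combination 2 * h - hnm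
    · rintro ⟨r, i⟩ _ ⟨r', i'⟩ _ h
      simp only [Prod.mk.injEq] at h ⊢
      omega
    · rintro ⟨x, y, z⟩ ha
      obtain ⟨ha, hf⟩ := Finset.mem_filter.mp ha
      simp only [Prod.mk.injEq] at hf
      obtain ⟨hx, hy, hz, h⟩ := mem_windmills.mp ha
      have hodd := (windmill_generic hn h).1
      obtain rfl : z = y := hf.2.1
      obtain ⟨r, hr⟩ : ∃ r : ℕ, x = 2 * r + 1 := ⟨(x / 2).toNat, by omega⟩
      obtain ⟨i, hi⟩ : ∃ i : ℕ, z = i + 1 := ⟨(z - 1).toNat, by omega⟩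
      have hm' : 2 * (r * (r + 1)) + (i + 1) ^ 2 = m := by
        zify
        rw [hr, hi] at h
        linarith
      refine ⟨(r, i), Finset.mem_filter.mpr ⟨Finset.mem_product.mpr ⟨Finset.mem_range.mpr ?_,
        Finset.mem_range.mpr ?_⟩, hm'⟩, ?_⟩
      · nlinarith
      · nlinarith
      · simp only [hr, hi]
  have h₂ : ((Finset.range N ×ˢ Finset.range N).filter
      fun a => 2 * (a.1 * (a.1 + 1)) + (2 * a.1 + 1) * (a.2 + 1) = m).card =
      ((windmills n).filter fun a => windmillFlip a = a).card := by
    refine Finset.card_bij (fun a _ => ((2 * a.1 + 1 : ℤ), (2 * a.1 + 1 : ℤ), (a.2 + 1 : ℤ)))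
      ?_ ?_ ?_
    · rintro ⟨r, i⟩ ha
      have h := (Finset.mem_filter.mp ha).2
      zify at h
      have hw : ((2 * r + 1 : ℤ), (2 * r + 1 : ℤ), (i + 1 : ℤ)) ∈ windmills n := by
        refine mem_windmills.mpr ⟨by positivity, by positivity, by positivity, ?_⟩
        linear_combination 2 * h - hnm
      exact Finset.mem_filter.mpr ⟨hw, (windmillFlip_fixed hn hw).mpr rfl⟩
    · rintro ⟨r, i⟩ _ ⟨r', i'⟩ _ h
      simp only [Prod.mk.injEq] at h ⊢
      omega
    · rintro ⟨x, y, z⟩ ha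
      obtain ⟨ha, hf⟩ := Finset.mem_filter.mp ha
      obtain ⟨hx, hy, hz, h⟩ := mem_windmills.mp ha
      have hodd := (windmill_generic hn h).1
      obtain rfl : y = x := (windmillFlip_fixed hn ha).mp hf
      obtain ⟨r, hr⟩ : ∃ r : ℕ, y = 2 * r + 1 := ⟨(y / 2).toNat, by omega⟩
      obtain ⟨i, hi⟩ : ∃ i : ℕ, z = i + 1 := ⟨(z - 1).toNat, by omega⟩
      have hm' : 2 * (r * (r + 1)) + (2 * r + 1) * (i + 1) = m := by
        zify
        rw [hr, hi] at h
        linarith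
      refine ⟨(r, i), Finset.mem_filter.mpr ⟨Finset.mem_product.mpr ⟨Finset.mem_range.mpr ?_,
        Finset.mem_range.mpr ?_⟩, hm'⟩, ?_⟩
      · nlinarith
      · nlinarith
      · simp only [hr, hi]
  -- Both sides are now fixed-point counts on the same set: of the swap y ↔ z (y = z) and of
  -- `windmillFlip` (y = x).
  rw [h₁, h₂, ← card_eq_card_fixed _ _ (windmillFlip_mem hn) (windmillFlip_flip hn),
    ← card_eq_card_fixed]
  · rintro ⟨x, y, z⟩ ha
    obtain ⟨hx, hy, hz, h⟩ := mem_windmills.mp ha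
    exact mem_windmills.mpr ⟨hx, hz, hy, by linear_combination h⟩
  · intro a _
    rfl

/-! ### Supports and parity of the products -/

/-- The power series in `X ^ d`. -/
def multiplesSupport (d : ℕ) : Subring ℤ⟦X⟧ where
  carrier := {f | ∀ n, ¬ d ∣ n → coeff n f = 0}
  zero_mem' := fun n _ => by simp
  one_mem' := fun n hn => by
    rw [coeff_one, if_neg]
    rintro rfl
    exact hn (dvd_zero d)
  add_mem' := fun {f g} hf hg n hn => by rw [map_add, hf n hn, hg n hn, add_zero]
  neg_mem' := fun {f} hf n hn => by rw [map_neg, hf n hn, neg_zero]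
  mul_mem' := fun {f g} hf hg n hn => by
    rw [coeff_mul]
    refine Finset.sum_eq_zero fun a ha => ?_
    rw [Finset.HasAntidiagonal.mem_antidiagonal] at ha
    by_cases h : d ∣ a.1
    · rw [hg a.2 fun h' => hn (ha ▸ dvd_add h h'), mul_zero]
    · rw [hf a.1 h, zero_mul]

theorem X_pow_mem_multiplesSupport {d e : ℕ} (h : d ∣ e) : (X ^ e : ℤ⟦X⟧) ∈ multiplesSupport d :=
  fun n hn => by
    rw [coeff_X_pow, if_neg]
    rintro rfl
    exact hn h

theorem qPochInf_mem {d : ℕ} {a q : ℤ⟦X⟧} (h : constantCoeff q = 0) (ha : a ∈ multiplesSupport d)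
    (hq : q ∈ multiplesSupport d) : qPochInf a q ∈ multiplesSupport d := fun n hn => by
  rw [(qPochInf_XCong h (X_pow_dvd_mul_pow a h (n + 1))).coeff_eq n.lt_succ_self]
  exact (prod_mem fun j _ => sub_mem (one_mem _) (mul_mem ha (pow_mem hq j)) :
    qPoch a q (n + 1) ∈ multiplesSupport d) n hn

theorem qinf_mem : qinf ∈ multiplesSupport 2 :=
  qPochInf_mem (by simp) (X_pow_mem_multiplesSupport dvd_rfl) (X_pow_mem_multiplesSupport dvd_rfl)

theorem minf_mem : minf ∈ multiplesSupport 2 :=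
  qPochInf_mem (by simp) (neg_mem (X_pow_mem_multiplesSupport dvd_rfl))
    (X_pow_mem_multiplesSupport dvd_rfl)

theorem coeff_evalNegHom (f : ℤ⟦X⟧) (n : ℕ) : coeff n (evalNegHom f) = (-1) ^ n * coeff n f := by
  rw [evalNegHom, coeff_rescale]

theorem evalNegHom_of_mem {f : ℤ⟦X⟧} (hf : f ∈ multiplesSupport 2) : evalNegHom f = f := by
  ext n
  rw [coeff_evalNegHom]
  rcases Nat.even_or_odd n with h | h
  · rw [h.neg_one_pow, one_mul]
  · rw [hf n (by rw [← even_iff_two_dvd]; exact Nat.not_even_iff_odd.mpr h), mul_zero]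

theorem qinf_mul_minf : qinf * minf = qPochInf (X ^ 4) (X ^ 4) := by
  refine eq_of_forall_XCong fun N => ?_
  have h₁ : XCong N (qPochInf (X ^ 4) (X ^ 4)) (qPoch (X ^ 4) (X ^ 4) N) :=
    qPochInf_XCong (by simp) (X_pow_dvd_mul_pow _ (by simp) N)
  refine ((((qinf_XCong N).mul (minf_XCong N)).mono (by omega)).trans (XCong.of_eq ?_)).trans h₁.symm
  rw [qfac, mfac, qPoch, qPoch, qPoch, ← Finset.prod_mul_distrib]
  exact Finset.prod_congr rfl fun j _ => by ring

theorem qinf_mul_minf_mem : qinf * minf ∈ multiplesSupport 4 := by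
  rw [qinf_mul_minf]
  exact qPochInf_mem (by simp) (X_pow_mem_multiplesSupport dvd_rfl)
    (X_pow_mem_multiplesSupport dvd_rfl)

theorem mfac_eq_qfac_add_two_mul (n : ℕ) : ∃ k, mfac n = qfac n + 2 * k := by
  induction n with
  | zero => exact ⟨0, by rw [mfac_zero, qfac_zero]; ring⟩
  | succ n ih =>
    obtain ⟨k, hk⟩ := ih
    exact ⟨k * (1 + X ^ (2 * (n + 1))) + qfac n * X ^ (2 * (n + 1)), by
      rw [mfac_succ, qfac_succ, hk]; ring⟩

theorem coeff_two_mul (n : ℕ) (f : ℤ⟦X⟧) : coeff n (2 * f) = 2 * coeff n f := by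
  rw [two_mul, map_add, two_mul]

/-- Since 1 + x ≡ 1 - x mod 2, the two infinite products agree mod 2; multiply their difference by
`minf`. -/
theorem minf_sq : ∃ k ∈ multiplesSupport 2, minf ^ 2 = qinf * minf + 2 * k := by
  have h (n : ℕ) : ∃ t, coeff n (minf - qinf) = 2 * t := by
    obtain ⟨k, hk⟩ := mfac_eq_qfac_add_two_mul n
    refine ⟨coeff n k, ?_⟩
    rw [((minf_XCong n).sub (qinf_XCong n)).coeff_eq (by omega), hk, add_sub_cancel_left,
      coeff_two_mul]
  choose t ht using h
  have e : minf - qinf = 2 * mk t := by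
    ext n
    rw [ht, coeff_two_mul, coeff_mk]
  refine ⟨minf * mk t, mul_mem minf_mem fun n hn => ?_, ?_⟩
  · have := sub_mem minf_mem qinf_mem n hn
    rw [ht] at this
    rw [coeff_mk]
    omega
  · linear_combination minf * e

theorem ASeries_mul : ASeries * oinf ^ 2 = minf := by
  have h : constantCoeff (oinf ^ 2) = 1 := by rw [map_pow, constantCoeff_oinf, one_pow]
  have e : ASeries = minf * recip (oinf ^ 2) := rfl
  rw [e]
  linear_combination minf * mul_recip h

/-! ### The congruence for A(q)B(-q) modulo 4 -/

theorem evalNegHom_cayley_XCong (N r : ℕ) : XCong N (evalNegHom (cayley r))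
    (1 + 2 * ∑ i ∈ Finset.range N, (-1) ^ (i + 1) * X ^ ((2 * r + 1) * (i + 1))) := by
  have hx : evalNegHom (X ^ (2 * r + 1) : ℤ⟦X⟧) = -X ^ (2 * r + 1) := by
    rw [map_pow, evalNegHom_X, Odd.neg_pow ⟨r, rfl⟩]
  have h₁ : (1 + X ^ (2 * r + 1)) * evalNegHom (cayley r) = 1 - X ^ (2 * r + 1) := by
    have h : (1 - X ^ (2 * r + 1)) * cayley r = 1 + X ^ (2 * r + 1) := by
      rw [cayley]
      linear_combination (1 + X ^ (2 * r + 1)) * mul_recip_one_sub r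
    have h' := congrArg evalNegHom h
    rw [map_mul, map_sub, map_add, map_one, hx] at h'
    linear_combination h'
  have h₂ (K : ℕ) : (1 + X ^ (2 * r + 1) : ℤ⟦X⟧) *
      ∑ i ∈ Finset.range K, (-1) ^ (i + 1) * X ^ ((2 * r + 1) * (i + 1)) =
      (-1) ^ K * X ^ ((2 * r + 1) * (K + 1)) - X ^ (2 * r + 1) := by
    induction K with
    | zero => simp
    | succ K ih => rw [Finset.sum_range_succ, mul_add, ih]; ring
  refine XCong.cancel_left (u := 1 + X ^ (2 * r + 1)) (by simp) ?_
  have h₃ : XCong N (2 * ((-1) ^ N * X ^ ((2 * r + 1) * (N + 1)))) 0 :=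
    XCong.zero_of_dvd (((pow_dvd_pow X (by nlinarith)).mul_left _).mul_left _)
  refine ((XCong.of_eq ?_).trans ((XCong.refl N (1 - X ^ (2 * r + 1))).add h₃.symm)).trans
    (XCong.of_eq ?_)
  · rw [h₁, add_zero]
  · linear_combination -2 * h₂ N

/-- The truncated theta series `∑_{r<N} (-1)^r q^{2r(r+1)}`. -/
noncomputable def triangularSum (N : ℕ) : ℤ⟦X⟧ :=
  ∑ r ∈ Finset.range N, (-1) ^ r * X ^ (2 * (r * (r + 1)))

/-- The truncated divisor-type series `∑_{r,i<N} ± q^{2r(r+1) + (2r+1)(i+1)}`. -/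
noncomputable def factorSum (N : ℕ) : ℤ⟦X⟧ :=
  ∑ a ∈ Finset.range N ×ˢ Finset.range N, (-1) ^ (a.1 + (a.2 + 1)) *
    X ^ (2 * (a.1 * (a.1 + 1)) + (2 * a.1 + 1) * (a.2 + 1))

theorem triangularSum_mem (N : ℕ) : triangularSum N ∈ multiplesSupport 4 := by
  refine sum_mem fun r _ => neg_one_pow_mul_mem (G := (multiplesSupport 4).toAddSubgroup)
    (X_pow_mem_multiplesSupport ?_) r
  obtain ⟨k, hk⟩ := (Nat.even_mul_succ_self r).two_dvd
  exact ⟨k, by rw [hk]; ring⟩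

theorem qinf_mul_evalNegHom_BSeries_XCong (N : ℕ) :
    XCong N (qinf * evalNegHom BSeries) (minf * (triangularSum N + 2 * factorSum N)) := by
  have h := (BSeries_XCong N).map_evalNeg
  rw [map_mul, map_mul, evalNegHom_of_mem qinf_mem, evalNegHom_of_mem minf_mem, map_sum] at h
  refine h.trans (XCong.mul_left _ ?_)
  rw [triangularSum, factorSum, Finset.sum_product, Finset.mul_sum, ← Finset.sum_add_distrib]
  refine XCong.sum fun r _ => ?_
  rw [map_mul, evalNegHom_of_mem (f := (-1) ^ r * X ^ (2 * (r * (r + 1)))) (mul_mem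
    (pow_mem (neg_mem (one_mem _)) r) (X_pow_mem_multiplesSupport (Dvd.intro _ rfl)))]
  refine ((evalNegHom_cayley_XCong N r).mul_left _).trans (XCong.of_eq ?_)
  have e : ∑ i ∈ Finset.range N, (-1) ^ (r + (i + 1)) *
      X ^ (2 * (r * (r + 1)) + (2 * r + 1) * (i + 1)) = (-1) ^ r * X ^ (2 * (r * (r + 1))) *
        ∑ i ∈ Finset.range N, (-1) ^ (i + 1) * (X ^ ((2 * r + 1) * (i + 1)) : ℤ⟦X⟧) := by
    rw [Finset.mul_sum]
    exact Finset.sum_congr rfl fun i _ => by ring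
  simp only [e]
  ring

theorem coeff_signed_sum {ι : Type*} (s : Finset ι) (k m : ι → ℕ) (j : ℕ) :
    ((coeff j (∑ a ∈ s, (-1) ^ k a * X ^ m a : ℤ⟦X⟧) : ℤ) : ZMod 2) =
      ((s.filter fun a => m a = j).card : ℕ) := by
  rw [map_sum, Int.cast_sum, Finset.card_filter, Nat.cast_sum]
  refine Finset.sum_congr rfl fun a _ => ?_
  rw [coeff_neg_one_pow_mul, coeff_X_pow]
  have : (((-1 : ℤ) ^ k a : ℤ) : ZMod 2) = 1 := by
    rw [Int.cast_pow]; simp [CharTwo.neg_eq]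
  rw [Int.cast_mul, this, one_mul]
  by_cases h : j = m a
  · simp [h]
  · simp [h, Ne.symm h]

/-- Signs disappear modulo 2, so both coefficients count solutions and the windmill argument
applies. -/
theorem even_coeff_factorSum_sub {j N : ℕ} (hj : j % 4 = 1) (hN : j ≤ N) :
    (2 : ℤ) ∣ coeff j (factorSum N - thetaSum N * triangularSum N) := by
  refine mod_cast (ZMod.intCast_zmod_eq_zero_iff_dvd
    (coeff j (factorSum N - thetaSum N * triangularSum N)) 2).mp ?_
  have e : thetaSum N * triangularSum N = ∑ a ∈ Finset.range N ×ˢ Finset.range N,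
      (-1) ^ (a.1 + (a.2 + 1)) * X ^ (2 * (a.1 * (a.1 + 1)) + (a.2 + 1) ^ 2) := by
    rw [mul_comm, thetaSum, triangularSum, Finset.sum_mul_sum, Finset.sum_product]
    exact Finset.sum_congr rfl fun r _ => Finset.sum_congr rfl fun i _ => by ring
  rw [map_sub, Int.cast_sub, e, factorSum, coeff_signed_sum, coeff_signed_sum,
    card_sq_rep_eq_card_factor hj hN, sub_self]

theorem coeff_ASeries_mul_modEq (n : ℕ) :
    coeff (4 * n + 1) (ASeries * evalNegHom BSeries) ≡ 0 [ZMOD 4] := by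
  obtain ⟨N, hN⟩ : ∃ N, N = 4 * n + 2 := ⟨_, rfl⟩
  obtain ⟨k, hk, hkm⟩ := minf_sq
  set D := ASeries * evalNegHom BSeries with hD
  set θ := thetaSum N
  set T := triangularSum N with hT
  set F := factorSum N
  have h₁ : XCong N (D * (1 + 2 * θ)) (minf ^ 2 * (T + 2 * F)) := by
    refine (((tripleProduct_XCong N).mono (by omega)).mul_left D).symm.trans ?_
    have h := (qinf_mul_evalNegHom_BSeries_XCong N).mul_left minf
    refine ((XCong.of_eq ?_).trans h).trans (XCong.of_eq (by ring))
    rw [hD, ← ASeries_mul]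
    ring
  -- This factor inverts 1 + 2θ modulo 4, the product being 1 - 4θ².
  have h₂ := (h₁.mul_right (1 - 2 * θ)).coeff_eq (show 4 * n + 1 < N by omega)
  have e₁ : D * (1 + 2 * θ) * (1 - 2 * θ) = D - 2 * (2 * (D * θ ^ 2)) := by ring
  have e₂ : minf ^ 2 * (T + 2 * F) * (1 - 2 * θ) = qinf * minf * T + 2 * (k * T)
      + 2 * (qinf * minf * (F - θ * T))
      + 2 * (2 * (k * (F - θ * T) - minf ^ 2 * F * θ)) := by rw [hkm]; ring
  have z₁ : coeff (4 * n + 1) (qinf * minf * T) = 0 :=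
    mul_mem qinf_mul_minf_mem (triangularSum_mem N) _ (by omega)
  have hT2 : T ∈ multiplesSupport 2 := fun m hm => triangularSum_mem N m (by omega)
  have z₂ : coeff (4 * n + 1) (k * T) = 0 := mul_mem hk hT2 _ (by omega)
  obtain ⟨t, z₃⟩ : (2 : ℤ) ∣ coeff (4 * n + 1) (qinf * minf * (F - θ * T)) := by
    rw [coeff_mul]
    refine Finset.dvd_sum fun a ha => ?_
    rw [Finset.HasAntidiagonal.mem_antidiagonal] at ha
    -- As (q⁴;q⁴)_∞ is a series in q⁴, the other factor is only met at indices 1 mod 4.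
    by_cases h : 4 ∣ a.1
    · exact (even_coeff_factorSum_sub (by omega) (by omega)).mul_left _
    · rw [qinf_mul_minf_mem a.1 h, zero_mul]
      exact dvd_zero 2
  rw [e₁, e₂, map_sub, map_add, map_add, map_add, coeff_two_mul, coeff_two_mul, coeff_two_mul,
    coeff_two_mul, coeff_two_mul, coeff_two_mul, z₁, z₂, z₃] at h₂
  refine Int.modEq_zero_iff_dvd.mpr ⟨coeff (4 * n + 1) (D * θ ^ 2) + t +
    coeff (4 * n + 1) (k * (F - θ * T) - minf ^ 2 * F * θ), ?_⟩
  linarith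

end TwoColor

theorem theorem1p5 :
    (∀ n : ℕ, TwoColor.c (8 * n + 6) ≡ 0 [ZMOD 8]) ∧
    (∀ n : ℕ, PowerSeries.coeff (4 * n + 1)
      (TwoColor.ASeries * PowerSeries.evalNegHom TwoColor.BSeries) ≡ 0 [ZMOD 4]) :=
  ⟨TwoColor.c_modEq, TwoColor.coeff_ASeries_mul_modEq⟩
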